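/- Let $T>0$, and let $f:\mathbb R^n\to\mathbb R$ be smooth. Consider the continuity equation $\rho_t+\nabla\cdot(u\rho)+f(u)\rho=0$ in the strip $\Pi=\mathbb R^n\times(0,T)$. (1) Let $\bigcup_i\Gamma_i\cup\bigcup_j J_j\subset\Pi$ be a stratified manifold, closed in $\Pi$: its strata are pairwise disjoint, locally finite in number, of codimension $\ge1$; each one is the zero set, in some open $O\subset\Pi$, of a smooth map $S:O\to\mathbb R^{k}$ ($k$ its codimension) with surjective differential at the zeros; and a stratum that meets the closure of another one lies in it and has larger codimension. Let $\omega_i$ be the Leray measure of $\Gamma_i=\{S_i=0\}$, $dt\,dx=dS_{i,1}\cdots dS_{i,k_i}\,\omega_i$. On $\Gamma_i$ let $v_i$ be a continuous $\mathbb R^n$-valued field such that $D_i=\partial_t+(v_i,\nabla)$ is tangent to $\Gamma_i$ (e.g. the normal velocity). The trajectories of $D_i$ fiber $\Gamma_i$ and have end points, off $\Gamma_i$ (at $t=0$, at $t=T$ or on other strata). Let $\nu_i$ be a $\sigma$-finite measure on the set of these trajectories, and let $\mu_i>0$ be the density of $\omega_i$ with respect to the $D_i$-invariant measure $dt\,d\nu_i$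 on $\Gamma_i$. The sets $J_j$ are junctions, which carry no mass. (2) Let $u$ be smooth on $\Pi\setminus(\bigcup\Gamma_i\cup\bigcup J_j)$. Let its trajectories $t\mapsto X(x_0,t)$, $0\le t<\tau(x_0)\le T$, $X(x_0,0)=x_0$, where $x_0$ runs over an open set $D_0\subset\mathbb R^n$ of full measure and $\tau>0$ is lower semicontinuous, be smooth in $(x_0,t)$ and nonsingular ($|Dx/Dx_0|\ne0$), not intersect one another, and cover $\Pi\setminus(\bigcup\Gamma_i\cup\bigcup J_j)$; if $\tau(x_0)<T$, the trajectory enters $\bigcup\Gamma_i\cup\bigcup J_j$ at time $\tau(x_0)$, and for almost every such $x_0$ it enters $\bigcup\Gamma_i$. Given a smooth $\rho_0$ on $D_0$, let $R$ be the function $$R(X(x_0,t),t)=\rho_0(x_0)\,\Big|\frac{Dx}{Dx_0}\Big|^{-1}\exp\Big(-\int_0^t f(u(X(x_0,s),s))\,ds\Big),$$ and suppose that $R$, $uR$ and $f(u)R$ are integrable on bounded subsets of $\Pi$. (3) Suppose that there are functions $e_i$ on $\Gamma_i$, with $e_i$, $v_ie_i$, $f(v_i)e_i$ integrable with respect to $\omega_i$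 on bounded sets, that satisfy along the trajectories of $D_i$ the transport equations $$D_i(e_i\mu_i)+f(v_i)\,e_i\mu_i=F_i\,\mu_i ,$$ where $e_i\mu_i$ extends continuously along the trajectories to their end points and takes prescribed values at $t=0$ on those that issue at $t=0$. Here $F_i$ (integrable with respect to $\omega_i$ on bounded sets) is the density of the flux of $\rho=R+\sum_j e_j\delta(\Gamma_j)$ into $\Gamma_i$: for every $\zeta\in C_0^\infty(O_i)$, $$\lim_{\varepsilon\to+0}\;-\frac1\varepsilon\Big[\int_{0<|S_i|<\varepsilon}\zeta R\,\big(\partial_t+(u,\nabla)\big)|S_i|\,dx\,dt+\sum_j\int_{\Gamma_j\cap\{0<|S_i|<\varepsilon\}}\zeta e_j\,D_j|S_i|\,\omega_j\Big]=\int_{\Gamma_i}\zeta F_i\,\omega_i ,$$ where the left-hand side is the flux through the boundaries $\{|S_i|=s\}$ of tubes around $\Gamma_i$, averaged over $0<s<\varepsilon$. (4) Suppose that, moreover, the Kirchhoff laws hold on the junctions: the values of $e_i\mu_i$ at the end points of the trajectories of the $D_i$ in $\Pi$ are $\nu_i$-integrable over bounded sets of end points, and for every bounded Borel set $B\subset\bigcup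 J_j$ the sum over $i$ of the integrals of $e_i\mu_i$ with respect to $\nu_i$ over the trajectories that end in $B$ equals the same sum over the trajectories that start in $B$. Then there exist $R$ and $e_i$ such that $\rho=R+\sum_i e_i\delta(\Gamma_i)$ is a generalized $\delta$-shock-type solution: $R$ is smooth on $\Pi\setminus(\bigcup\Gamma_i\cup\bigcup J_j)$, the integrals below converge absolutely, and $$\int_0^T\!\!\int_{\mathbb R^n}\big(R\zeta_t+(uR,\nabla\zeta)-f(u)R\zeta\big)\,dx\,dt+\sum_i\int_{\Gamma_i}e_i\Big[\Big((v_i,\nabla)+\frac{\partial}{\partial t}-f(v_i)\Big)\zeta\Big]\omega_i=0$$ for all $\zeta\in C_0^\infty(\mathbb R^n\times(-\infty,T))$ with $\zeta(x,0)=0$. Here $R$ is given by the formula above, with $R|_{t=0}=\rho_0$ on $D_0$, and the $e_i$ solve the transport equations with the prescribed initial values and satisfy the Kirchhoff laws. -/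

import Mathlib

open MeasureTheory Set Filter Topology
open scoped ContDiff

noncomputable section

/-- Euclidean space `ℝⁿ`. -/
abbrev Space (n : ℕ) : Type := EuclideanSpace ℝ (Fin n)

/-- Space-time `ℝⁿ × ℝ`, with points `p = (x, t)`. -/
abbrev SpaceTime (n : ℕ) : Type := Space n × ℝ

/-- The open strip `ℝⁿ × (0, T)`. -/
def strip (n : ℕ) (T : ℝ) : Set (SpaceTime n) := {p | 0 < p.2 ∧ p.2 < T}

/-- `g` is integrable with respect to `σ` on every ball of space-time. -/
def LocInt {n : ℕ} {G : Type*} [NormedAddCommGroup G] (g : SpaceTime n → G)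
    (σ : Measure (SpaceTime n)) : Prop :=
  ∀ r : ℝ, IntegrableOn g (Metric.closedBall 0 r) σ

/-! ### Strata -/

/-- A smooth stratum `{S₁ = 0} ∩ ⋯ ∩ {S_k = 0}` of codimension `k ≥ 1`: the zero set, in an open
part `dom` of the strip, of a smooth map `S` whose differential is onto at the zeros. -/
structure Stratum (n : ℕ) (T : ℝ) where
  codim : ℕ
  one_le_codim : 1 ≤ codim
  dom : Set (SpaceTime n)
  isOpen_dom : IsOpen dom
  dom_subset : dom ⊆ strip n T
  S : SpaceTime n → EuclideanSpace ℝ (Fin codim)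
  smooth : ContDiffOn ℝ ∞ S dom
  submersion : ∀ p ∈ dom, S p = 0 → Function.Surjective (fderiv ℝ S p)

namespace Stratum

variable {n : ℕ} {T : ℝ}

/-- The set of points of the stratum. -/
def carrier (P : Stratum n T) : Set (SpaceTime n) := {p | p ∈ P.dom ∧ P.S p = 0}

/-- The punctured tube `{0 < |S| < ε}` around the stratum. -/
def tube (P : Stratum n T) (ε : ℝ) : Set (SpaceTime n) :=
  {p | p ∈ P.dom ∧ 0 < ‖P.S p‖ ∧ ‖P.S p‖ < ε}

/-- `σ` is the Leray measure of the stratum, `dt dx₁ ⋯ dxₙ = dS₁ ⋯ dS_k σ`; equivalently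
`∫ φ dσ = ⟨δ(S₁) ⋯ δ(S_k), φ⟩`, the limit of the mean of `φ` over `{|S| < ε}`
relative to the volume of the `ε`-ball in the space of values of `S`. -/
structure IsLerayMeasure (P : Stratum n T) (σ : Measure (SpaceTime n)) : Prop where
  concentrated : σ P.carrierᶜ = 0
  finite_on_compact : ∀ C ⊆ P.dom, IsCompact C → σ C < ⊤
  tendsto : ∀ φ : SpaceTime n → ℝ, Continuous φ → HasCompactSupport φ → tsupport φ ⊆ P.dom →
    Tendsto (fun ε : ℝ =>
        (volume.real (Metric.ball (0 : EuclideanSpace ℝ (Fin P.codim)) ε))⁻¹ *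
          ∫ p in {p | p ∈ P.dom ∧ ‖P.S p‖ < ε}, φ p)
      (𝓝[>] 0) (𝓝 (∫ p, φ p ∂σ))

/-- `(v, ∇) + ∂/∂t` is a continuous tangent field of the stratum. -/
structure IsVelocity (P : Stratum n T) (v : SpaceTime n → Space n) : Prop where
  continuousOn : ContinuousOn v P.carrier
  tangent : ∀ p ∈ P.carrier, fderiv ℝ P.S p (v p, 1) = 0

/-- The trajectories of `(v, ∇) + ∂/∂t`, labelled by `y : Y`, fiber the stratum. The trajectory
`y` is `t ↦ (path y t, t)`, `start y < t < finish y`; it has end points, which are off the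
stratum. -/
structure Fibration (P : Stratum n T) (v : SpaceTime n → Space n)
    (Y : Type*) [MeasurableSpace Y] where
  start : Y → ℝ
  finish : Y → ℝ
  path : Y → ℝ → Space n
  measurable_start : Measurable start
  measurable_finish : Measurable finish
  measurable_path : Measurable (fun q : Y × ℝ => path q.1 q.2)
  start_nonneg : ∀ y, 0 ≤ start y
  start_lt_finish : ∀ y, start y < finish y
  finish_le : ∀ y, finish y ≤ T
  continuousOn : ∀ y, ContinuousOn (path y) (Icc (start y) (finish y))
  mem : ∀ y, ∀ t ∈ Ioo (start y) (finish y), (path y t, t) ∈ P.carrier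
  ode : ∀ y, ∀ t ∈ Ioo (start y) (finish y), HasDerivAt (path y) (v (path y t, t)) t
  fiber : ∀ p ∈ P.carrier, ∃! y, p.2 ∈ Ioo (start y) (finish y) ∧ path y p.2 = p.1
  start_not_mem : ∀ y, (path y (start y), start y) ∉ P.carrier
  finish_not_mem : ∀ y, (path y (finish y), finish y) ∉ P.carrier

/-- The measure `∫ ν(dy) ∫ dt` on the stratum, invariant under the field `(v, ∇) + ∂/∂t`:
`dt` along the trajectories, and a measure `ν` on the set of trajectories. -/
def Fibration.invariantMeasure {P : Stratum n T} {v : SpaceTime n → Space n}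
    {Y : Type*} [MeasurableSpace Y] (Φ : P.Fibration v Y) (ν : Measure Y) :
    Measure (SpaceTime n) :=
  ((ν.prod volume).restrict {q : Y × ℝ | q.2 ∈ Ioo (Φ.start q.1) (Φ.finish q.1)}).map
    (fun q => (Φ.path q.1 q.2, q.2))

/-- `μ > 0` is the density of `σ` with respect to the invariant measure. -/
structure Fibration.IsDensity {P : Stratum n T} {v : SpaceTime n → Space n}
    {Y : Type*} [MeasurableSpace Y] (Φ : P.Fibration v Y) (ν : Measure Y)
    (σ : Measure (SpaceTime n)) (μ : SpaceTime n → ℝ) : Prop where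
  measurable : Measurable μ
  pos : ∀ p ∈ P.carrier, 0 < μ p
  eq : σ = (Φ.invariantMeasure ν).withDensity (fun p => ENNReal.ofReal (μ p))

end Stratum

/-- The union of a family of strata. -/
def strataUnion {n : ℕ} {T : ℝ} {ι : Type*} (Γ : ι → Stratum n T) : Set (SpaceTime n) :=
  ⋃ i, (Γ i).carrier

/-- The strata form a stratified manifold: they are disjoint, locally finite in number, their union
is closed in the strip, and the closure of a stratum consists of it and of whole strata of
larger codimension. -/
structure IsStratified {n : ℕ} {T : ℝ} {ι : Type*} (Γ : ι → Stratum n T) : Prop where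
  disjoint : ∀ i j, i ≠ j → Disjoint (Γ i).carrier (Γ j).carrier
  locallyFinite : ∀ r : ℝ, {i | ((Γ i).carrier ∩ Metric.closedBall 0 r).Nonempty}.Finite
  closed : closure (strataUnion Γ) ∩ strip n T ⊆ strataUnion Γ
  frontier : ∀ i j, i ≠ j → (closure (Γ i).carrier ∩ (Γ j).carrier).Nonempty →
    (Γ j).carrier ⊆ closure (Γ i).carrier ∧ (Γ i).codim < (Γ j).codim

/-! ### Trajectories of the velocity field and the regular part -/

/-- `X x₀ t`, `0 ≤ t < τ x₀`, are the trajectories of `u`, issuing at `t = 0` from the points `x₀`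
of the open set `D₀` of full measure. Off the singular set `Γ ∪ K` they are smooth and
nonsingular, they do not intersect, and they sweep out the complement of `Γ ∪ K` (so none of them
leaves `Γ ∪ K`); a trajectory that ends at `τ x₀ < T` enters `Γ ∪ K` at that time, and almost
every one of these enters `Γ`. -/
structure IsEnteringFlow {n : ℕ} (T : ℝ) (u : SpaceTime n → Space n) (Γ K : Set (SpaceTime n))
    (D₀ : Set (Space n)) (τ : Space n → ℝ) (X : Space n → ℝ → Space n) : Prop where
  isOpen : IsOpen D₀
  full : volume D₀ᶜ = 0
  pos : ∀ x₀ ∈ D₀, 0 < τ x₀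
  le : ∀ x₀ ∈ D₀, τ x₀ ≤ T
  lsc : LowerSemicontinuousOn τ D₀
  smooth : ContDiffOn ℝ ∞ (fun q : SpaceTime n => X q.1 q.2)
    {q | q.1 ∈ D₀ ∧ 0 ≤ q.2 ∧ q.2 < τ q.1}
  init : ∀ x₀ ∈ D₀, X x₀ 0 = x₀
  ode : ∀ x₀ ∈ D₀, ∀ t ∈ Ioo 0 (τ x₀), HasDerivAt (X x₀) (u (X x₀ t, t)) t
  avoid : ∀ x₀ ∈ D₀, ∀ t ∈ Ioo 0 (τ x₀), (X x₀ t, t) ∉ Γ ∪ K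
  nonsingular : ∀ x₀ ∈ D₀, ∀ t ∈ Ioo 0 (τ x₀), (fderiv ℝ (fun z => X z t) x₀).det ≠ 0
  inj : ∀ x₀ ∈ D₀, ∀ x₁ ∈ D₀, ∀ t, t ∈ Ioo 0 (τ x₀) → t ∈ Ioo 0 (τ x₁) →
    X x₀ t = X x₁ t → x₀ = x₁
  cover : ∀ p ∈ strip n T, p ∉ Γ ∪ K → ∃ x₀ ∈ D₀, p.2 < τ x₀ ∧ X x₀ p.2 = p.1
  enter : ∀ x₀ ∈ D₀, τ x₀ < T →
    ∃ z, (z, τ x₀) ∈ Γ ∪ K ∧ Tendsto (X x₀) (𝓝[<] (τ x₀)) (𝓝 z)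
  enter_ae : ∀ᵐ x₀ : Space n, x₀ ∈ D₀ → τ x₀ < T →
    ∃ z, (z, τ x₀) ∈ Γ ∧ Tendsto (X x₀) (𝓝[<] (τ x₀)) (𝓝 z)

/-- `ρ₀(x₀) |Dx/Dx₀|⁻¹ exp(-∫₀ᵗ f(u) dt')`, the integral along the trajectory of `x₀`. -/
def alongTrajectory {n : ℕ} (u : SpaceTime n → Space n) (f : Space n → ℝ)
    (X : Space n → ℝ → Space n) (ρ₀ : Space n → ℝ) (x₀ : Space n) (t : ℝ) : ℝ :=
  ρ₀ x₀ * |(fderiv ℝ (fun z => X z t) x₀).det|⁻¹ *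
    Real.exp (-∫ s in (0 : ℝ)..t, f (u (X x₀ s, s)))

/-- The function of `(x, t)` given by the Cauchy formula: its value at `(X x₀ t, t)` is
`alongTrajectory u f X ρ₀ x₀ t`. -/
def cauchyDensity {n : ℕ} (u : SpaceTime n → Space n) (f : Space n → ℝ) (D₀ : Set (Space n))
    (τ : Space n → ℝ) (X : Space n → ℝ → Space n) (ρ₀ : Space n → ℝ) (p : SpaceTime n) : ℝ :=
  alongTrajectory u f X ρ₀
    (Function.invFunOn (fun x₀ => X x₀ p.2) {x₀ | x₀ ∈ D₀ ∧ p.2 < τ x₀} p.1) p.2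

/-- `R`, `u R` and `f(u) R` are locally integrable. -/
structure IsRegularDensity {n : ℕ} (T : ℝ) (u : SpaceTime n → Space n) (f : Space n → ℝ)
    (R : SpaceTime n → ℝ) : Prop where
  density : LocInt R (volume.restrict (strip n T))
  flux : LocInt (fun p => R p • u p) (volume.restrict (strip n T))
  source : LocInt (fun p => f (u p) * R p) (volume.restrict (strip n T))

/-- `e`, `v e` and `f(v) e` are locally integrable with respect to `σ`. -/
structure IsAmplitude {n : ℕ} (f : Space n → ℝ) (σ : Measure (SpaceTime n))
    (v : SpaceTime n → Space n) (e : SpaceTime n → ℝ) : Prop where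
  density : LocInt e σ
  flux : LocInt (fun p => e p • v p) σ
  source : LocInt (fun p => f (v p) * e p) σ

/-! ### The equations on the strata -/

/-- The flux of `ρ = R + Σ eⱼ δ(Γⱼ)` into the tube `{|S| < ε}` around the stratum `P`, tested with
`ζ` and averaged over the tube boundaries `{|S| = s}`, `0 < s < ε`: by the definition of the
Leray measures of these boundaries the average is `1/ε` times a volume integral over the tube.
Velocities are `u` off the strata and `vⱼ` on `Γⱼ`, and the normal component of the space-time
velocity `(u, 1)` is its derivative of `|S|`. -/
def tubeInflux {n : ℕ} {T : ℝ} {ι : Type*} (P : Stratum n T) (u : SpaceTime n → Space n)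
    (R : SpaceTime n → ℝ) (v : ι → SpaceTime n → Space n) (σ : ι → Measure (SpaceTime n))
    (e : ι → SpaceTime n → ℝ) (ζ : SpaceTime n → ℝ) (ε : ℝ) : ℝ :=
  -(ε⁻¹ * ((∫ p in P.tube ε, ζ p * R p * fderiv ℝ (fun q => ‖P.S q‖) p (u p, 1)) +
    ∑ᶠ j, ∫ p in P.tube ε, ζ p * e j p * fderiv ℝ (fun q => ‖P.S q‖) p (v j p, 1) ∂(σ j)))

/-- `F` is the density of the flux of `ρ = R + Σ eⱼ δ(Γⱼ)` into the stratum `P` with Leray measure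
`σP`: the fluxes through the boundaries of shrinking tubes tend to `∫ ζ F dσP`. -/
structure IsFluxDensity {n : ℕ} {T : ℝ} {ι : Type*} (P : Stratum n T)
    (σP : Measure (SpaceTime n)) (u : SpaceTime n → Space n)
    (R : SpaceTime n → ℝ) (v : ι → SpaceTime n → Space n) (σ : ι → Measure (SpaceTime n))
    (e : ι → SpaceTime n → ℝ) (F : SpaceTime n → ℝ) : Prop where
  integrable : LocInt F σP
  tendsto : ∀ ζ : SpaceTime n → ℝ, ContDiff ℝ ∞ ζ → HasCompactSupport ζ → tsupport ζ ⊆ P.dom →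
    Tendsto (tubeInflux P u R v σ e ζ) (𝓝[>] 0) (𝓝 (∫ p in P.carrier, ζ p * F p ∂σP))

/-- On (almost) every trajectory of `(v, ∇) + ∂/∂t` in the stratum, the transport equation
`((v, ∇) + ∂/∂t)(e μ) + f(v) e μ = F μ` holds. Moreover `w y` is the continuous extension of `e μ`
along the trajectory `y` to the end points, with value `w₀ y` at `t = 0` if the trajectory
issues there. -/
def SolvesTransport {n : ℕ} {T : ℝ} {P : Stratum n T} {v : SpaceTime n → Space n}
    {Y : Type*} [MeasurableSpace Y] (Φ : P.Fibration v Y) (ν : Measure Y) (f : Space n → ℝ)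
    (μ e F : SpaceTime n → ℝ) (w₀ : Y → ℝ) (w : Y → ℝ → ℝ) : Prop :=
  ∀ᵐ y ∂ν,
    (∀ t ∈ Ioo (Φ.start y) (Φ.finish y),
      HasDerivAt (fun s => e (Φ.path y s, s) * μ (Φ.path y s, s))
        (F (Φ.path y t, t) * μ (Φ.path y t, t)
          - f (v (Φ.path y t, t)) * (e (Φ.path y t, t) * μ (Φ.path y t, t))) t) ∧
    ContinuousOn (w y) (Icc (Φ.start y) (Φ.finish y)) ∧
    (∀ t ∈ Ioo (Φ.start y) (Φ.finish y), w y t = e (Φ.path y t, t) * μ (Φ.path y t, t)) ∧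
    (Φ.start y = 0 → w y 0 = w₀ y)

/-- The Kirchhoff laws on the junction set `K`: the amplitude `e μ` carried into any bounded part
`B` of `K` by the trajectories that end there equals the amplitude carried away from `B` by the
trajectories that start there. The amplitudes at the end points are locally integrable. -/
structure KirchhoffLaws {n : ℕ} {T : ℝ} {ι : Type*} {Γ : ι → Stratum n T}
    {v : ι → SpaceTime n → Space n} {Y : ι → Type*} [∀ i, MeasurableSpace (Y i)]
    (Φ : ∀ i, (Γ i).Fibration (v i) (Y i)) (ν : ∀ i, Measure (Y i)) (K : Set (SpaceTime n))
    (w : ∀ i, Y i → ℝ → ℝ) : Prop where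
  integrable_finish : ∀ i, ∀ r : ℝ, IntegrableOn (fun y => w i y ((Φ i).finish y))
    {y | (Φ i).finish y < T ∧
      ((Φ i).path y ((Φ i).finish y), (Φ i).finish y) ∈ Metric.closedBall 0 r} (ν i)
  integrable_start : ∀ i, ∀ r : ℝ, IntegrableOn (fun y => w i y ((Φ i).start y))
    {y | 0 < (Φ i).start y ∧
      ((Φ i).path y ((Φ i).start y), (Φ i).start y) ∈ Metric.closedBall 0 r} (ν i)
  balance : ∀ B ⊆ K, MeasurableSet B → Bornology.IsBounded B →
    ∑ᶠ i, ∫ y in {y | ((Φ i).path y ((Φ i).finish y), (Φ i).finish y) ∈ B},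
        w i y ((Φ i).finish y) ∂(ν i) =
      ∑ᶠ i, ∫ y in {y | ((Φ i).path y ((Φ i).start y), (Φ i).start y) ∈ B},
        w i y ((Φ i).start y) ∂(ν i)

/-! ### Generalized solutions -/

/-- `ρ = R + Σ eᵢ δ(Γᵢ)`, with `R` smooth in the strip off the singular set `Γ ∪ K`, is a
generalized δ-shock-type solution of `ρ_t + (∇, u ρ) + f(u) ρ = 0`: the integral identity
`∫∫ R (ζ_t + (u, ∇ζ) - f(u) ζ) dx dt + Σ ∫_{Γᵢ} eᵢ (ζ_t + (vᵢ, ∇ζ) - f(vᵢ) ζ) dσᵢ = 0`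
holds for the test functions `ζ` with `ζ(x, 0) = 0` and support in `{t < T}`, and the integrals
converge absolutely. -/
structure IsDeltaShockSolution {n : ℕ} {T : ℝ} {ι : Type*} (Γ : ι → Stratum n T)
    (K : Set (SpaceTime n)) (u : SpaceTime n → Space n) (f : Space n → ℝ)
    (v : ι → SpaceTime n → Space n) (σ : ι → Measure (SpaceTime n))
    (R : SpaceTime n → ℝ) (e : ι → SpaceTime n → ℝ) : Prop where
  smooth : ContDiffOn ℝ ∞ R (strip n T \ (strataUnion Γ ∪ K))
  regular : IsRegularDensity T u f R
  amplitude : ∀ i, IsAmplitude f (σ i) (v i) (e i)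
  identity : ∀ ζ : SpaceTime n → ℝ, ContDiff ℝ ∞ ζ → HasCompactSupport ζ →
    tsupport ζ ⊆ {p | p.2 < T} → (∀ x, ζ (x, 0) = 0) →
    (∫ p in strip n T, R p * (fderiv ℝ ζ p (u p, 1) - f (u p) * ζ p)) +
      ∑ᶠ i, ∫ p in (Γ i).carrier,
        e i p * (fderiv ℝ ζ p (v i p, 1) - f (v i p) * ζ p) ∂(σ i) = 0

/-- The equations on all strata, for `ρ = R + Σ eᵢ δ(Γᵢ)`: every `eᵢ` solves the transport equation
on `Γᵢ` in which `Fᵢ` is the density of the flux of `ρ` into `Γᵢ`, with the initial values `w₀`,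
and the Kirchhoff laws hold on `K`. -/
structure SolvesStrata {n : ℕ} {T : ℝ} {ι : Type*} {Γ : ι → Stratum n T}
    {v : ι → SpaceTime n → Space n} {Y : ι → Type*} [∀ i, MeasurableSpace (Y i)]
    (Φ : ∀ i, (Γ i).Fibration (v i) (Y i)) (ν : ∀ i, Measure (Y i)) (K : Set (SpaceTime n))
    (u : SpaceTime n → Space n) (f : Space n → ℝ)
    (σ : ι → Measure (SpaceTime n)) (μ : ι → SpaceTime n → ℝ)
    (w₀ : ∀ i, Y i → ℝ) (R : SpaceTime n → ℝ)
    (e F : ι → SpaceTime n → ℝ) (w : ∀ i, Y i → ℝ → ℝ) : Prop where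
  amplitude : ∀ i, IsAmplitude f (σ i) (v i) (e i)
  flux : ∀ i, IsFluxDensity (Γ i) (σ i) u R v σ e (F i)
  transport : ∀ i, SolvesTransport (Φ i) (ν i) f (μ i) (e i) (F i) (w₀ i) (w i)
  kirchhoff : KirchhoffLaws Φ ν K w

end

/-! The proof is a mass balance along trajectories. The regular part and each `eᵢ δ(Γᵢ)` are treated
alike, as a `Sweep`: a mass carried along curves, whose amplitude (density times Jacobian, or `e μ`)
satisfies a linear ODE with damping `c` and source `F`. On one curve the derivative of the amplitude
times a test function `φ` is an explicit integrand. Integrating in time and then over the labels of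
the curves gives `Sweep.integral_eq_boundary`: the weak form of the transport equation equals
`boundary φ`, the amplitude tested with `φ` at the final points minus that at the initial points.

The sources are identified by the same balance. Take `φ = ζ · min(|S|/ε, 1)`, which vanishes on the
stratum `P = {S = 0}`, and subtract the result from the balance for `ζ` weighted with the ramp. Only
the flux through the tube `{0 < |S| < ε}` is left, besides boundary terms. As `ε → 0` this flux
tends to `boundary (ζ · 1_P)` (`Sweep.tendsto_tube_flux`): what flows into the stratum is what the
curves ending on it bring, less what the curves starting on it take away. Hence `∫ ζ Fᵢ dσᵢ` is the
sum over all sweeps of `boundary (ζ · 1_{Γᵢ})` (`IsFluxDensity.integral_mul_eq_boundary`).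

In the identity the regular integral is `B.boundary ζ`, where `B` is the sweep of the flow, and the
integral over `Γᵢ` is `(A i).boundary ζ - ∫ ζ Fᵢ dσᵢ`, where `A i` is the sweep of that stratum.
Almost all curves of `B` end on `Γ` or where `ζ = 0`, and `ζ = 0` at their start. The curves of `A
i` have their end points on `Γ`, on the junctions, or where `ζ = 0`, because the stratified set is
closed in the strip. All contributions on `Γ` cancel against the fluxes, and the contributions on
the junctions cancel by the Kirchhoff laws.

Since `supp ζ` lies in `{t < T'}` for some `T' < T`, the flow is stopped at `T'`; this gives every
trajectory a final point. Smoothness of the regular density follows from the inverse function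
theorem applied to `(x₀, t) ↦ (X x₀ t, t)`. -/

/-! ### Preliminaries: level sets, determinants, cutoffs, parameter integrals, signed sums of
measures. -/

/-- A level set of a function of one variable has only countably many points at which the
derivative exists and does not vanish. -/
theorem countable_level_hasDerivAt_ne_zero (g : ℝ → ℝ) (c : ℝ) :
    {t : ℝ | g t = c ∧ ∃ g' : ℝ, g' ≠ 0 ∧ HasDerivAt g g' t}.Countable := by
  set A := {t : ℝ | g t = c ∧ ∃ g' : ℝ, g' ≠ 0 ∧ HasDerivAt g g' t} with hA
  -- A nonzero derivative keeps `g` away from `c` in a punctured neighbourhood, so each such point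
  -- is isolated in the set; a set of reals has only countably many points isolated from the right.
  refine (countable_setOfPred_isolated_right_within (s := A)).mono ?_
  rintro t ⟨ht, g', hg', hd⟩
  refine ⟨⟨ht, g', hg', hd⟩, ?_⟩
  have h1 : ∀ᶠ z in 𝓝[≠] t, g z ≠ c := hd.eventually_ne hg'
  have h2 : 𝓝[A ∩ Ioi t] t ≤ 𝓝[≠] t :=
    nhdsWithin_mono _ fun z hz => (ne_of_gt hz.2)
  have h3 : ∀ᶠ z in 𝓝[A ∩ Ioi t] t, z ∈ A ∩ Ioi t := self_mem_nhdsWithin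
  rw [← Filter.eventually_false_iff_eq_bot]
  filter_upwards [h2 h1, h3] with z hz hz' using hz hz'.1.1

/-- The matrix of `L` is block triangular with lower right block 1. This reduces the Jacobian of the
time-preserving map `(x, t) ↦ (X x t, t)` to `|Dx/Dx₀|`. -/
theorem ContinuousLinearMap.det_of_snd_eq {E : Type*} [NormedAddCommGroup E] [NormedSpace ℝ E]
    [FiniteDimensional ℝ E] (L : E × ℝ →L[ℝ] E × ℝ) (A : E →L[ℝ] E)
    (hA : ∀ h, (L (h, 0)).1 = A h) (h2 : ∀ z, (L z).2 = z.2) : L.det = A.det := by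
  classical
  let b := Module.finBasis ℝ E
  let c := Module.Basis.singleton Unit ℝ
  rw [ContinuousLinearMap.det, ContinuousLinearMap.det, ← LinearMap.det_toMatrix (b.prod c),
    ← LinearMap.det_toMatrix b]
  have : LinearMap.toMatrix (b.prod c) (b.prod c) (L : E × ℝ →ₗ[ℝ] E × ℝ) =
      Matrix.fromBlocks (LinearMap.toMatrix b b (A : E →ₗ[ℝ] E))
        (Matrix.of fun i _ => b.repr (L (0, 1)).1 i) 0 1 := by
    ext (i | i) (j | j) <;> simp [LinearMap.toMatrix_apply, hA, h2, c]
  rw [this, Matrix.det_fromBlocks_zero₂₁, Matrix.det_one, mul_one]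

/-- In a basis the determinant is a polynomial in the matrix entries, which are continuous linear in
`A`. -/
theorem ContDiffOn.clm_det {E G : Type*} [NormedAddCommGroup E] [NormedSpace ℝ E]
    [FiniteDimensional ℝ E] [NormedAddCommGroup G] [NormedSpace ℝ G] {A : G → E →L[ℝ] E}
    {s : Set G} {k : WithTop ℕ∞} (hA : ContDiffOn ℝ k A s) :
    ContDiffOn ℝ k (fun p => (A p).det) s := by
  classical
  let b := Module.finBasis ℝ E
  have h : (fun p => (A p).det) = fun p =>
      ∑ π : Equiv.Perm (Fin (Module.finrank ℝ E)), (Equiv.Perm.sign π : ℤ) *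
        ∏ i, LinearMap.toContinuousLinearMap (b.coord (π i)) (A p (b i)) := by
    funext p
    rw [ContinuousLinearMap.det, ← LinearMap.det_toMatrix b, Matrix.det_apply']
    simp [LinearMap.toMatrix_apply]
  rw [h]
  refine ContDiffOn.sum fun π _ => contDiffOn_const.mul (contDiffOn_prod fun i _ => ?_)
  exact (ContinuousLinearMap.contDiff _).comp_contDiffOn (hA.clm_apply contDiffOn_const)

/-- An open set is exhausted by smooth cutoff functions with compact support in it. -/
theorem IsOpen.exists_smooth_cutoffs {E : Type*} [NormedAddCommGroup E] [NormedSpace ℝ E]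
    [FiniteDimensional ℝ E] {O : Set E} (hO : IsOpen O) :
    ∃ χ : ℕ → E → ℝ, (∀ k, ContDiff ℝ ∞ (χ k)) ∧ (∀ k, HasCompactSupport (χ k)) ∧
      (∀ k, tsupport (χ k) ⊆ O) ∧ (∀ k x, 0 ≤ χ k x ∧ χ k x ≤ 1) ∧
      ∀ x ∈ O, ∀ᶠ k in atTop, χ k x = 1 := by
  obtain ⟨C, hCc, hCO, hCU, hCm⟩ := hO.exists_iUnion_isClosed
  have key : ∀ k : ℕ, ∃ χ : E → ℝ, ContDiff ℝ ∞ χ ∧ HasCompactSupport χ ∧ tsupport χ ⊆ O ∧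
      (∀ x, 0 ≤ χ x ∧ χ x ≤ 1) ∧ ∀ x ∈ C k ∩ Metric.closedBall 0 (k : ℝ), χ x = 1 := by
    intro k
    have hK : IsCompact (C k ∩ Metric.closedBall 0 (k : ℝ)) :=
      (isCompact_closedBall 0 (k : ℝ)).inter_left (hCc k)
    obtain ⟨V, hV, hKV, hVO, hVc⟩ := exists_open_between_and_isCompact_closure hK hO
      (inter_subset_left.trans (hCO k))
    obtain ⟨χ, hχ, hr, hs, h1⟩ := exists_contMDiff_support_eq_eq_one_iff
      (modelWithCornersSelf ℝ E) (n := ⊤) hV hK.isClosed hKV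
    refine ⟨χ, contMDiff_iff_contDiff.1 hχ, ?_, ?_, fun x => hr (mem_range_self x),
      fun x hx => (h1 x).1 hx⟩
    · rw [HasCompactSupport, tsupport, hs]; exact hVc
    · rw [tsupport, hs]; exact hVO
  choose χ h1 h2 h3 h4 h5 using key
  refine ⟨χ, h1, h2, h3, h4, fun x hx => ?_⟩
  rw [← hCU] at hx
  obtain ⟨i, hi⟩ := mem_iUnion.1 hx
  obtain ⟨m, hm⟩ := exists_nat_ge ‖x‖
  filter_upwards [eventually_ge_atTop i, eventually_ge_atTop m] with k hk hk'
  refine h5 k x ⟨hCm hk hi, ?_⟩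
  rw [mem_closedBall_zero_iff]
  exact hm.trans (by exact_mod_cast hk')

theorem ContinuousOn.integral_zero_one {E F : Type*} [NormedAddCommGroup E] [NormedSpace ℝ E]
    [NormedAddCommGroup F] [NormedSpace ℝ F] {P : Set E} {g : E × ℝ → F}
    (hg : ContinuousOn g (P ×ˢ Icc 0 1)) :
    ContinuousOn (fun p => ∫ s in (0 : ℝ)..1, g (p, s)) P := by
  rw [continuousOn_iff_continuous_domRestrict]
  have h01 : (0 : ℝ) ≤ 1 := zero_le_one
  have hc : Continuous (Function.uncurry fun (p : P) (s : ℝ) => g (p, projIcc 0 1 h01 s)) := by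
    refine hg.comp_continuous
      ((continuous_subtype_val.comp continuous_fst).prodMk
        (continuous_subtype_val.comp (continuous_projIcc.comp continuous_snd))) ?_
    rintro ⟨p, s⟩
    exact ⟨p.2, (projIcc 0 1 h01 s).2⟩
  have h2 := intervalIntegral.continuous_parametric_intervalIntegral_of_continuous' (μ := volume)
    hc 0 1
  refine h2.congr fun p => ?_
  refine intervalIntegral.integral_congr fun s hs => ?_
  rw [uIcc_of_le h01] at hs
  simp [projIcc_of_mem h01 hs]

/-- Induction on the order, differentiating under the integral. The codomain is quantified inside
the induction because the derivative takes values in `E →L[ℝ] F`. -/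
theorem ContDiffOn.integral_zero_one_nat {E : Type} [NormedAddCommGroup E] [NormedSpace ℝ E]
    [FiniteDimensional ℝ E] {P : Set E} (hP : IsOpen P) (k : ℕ) :
    ∀ {F : Type} [NormedAddCommGroup F] [NormedSpace ℝ F] {g : E × ℝ → F},
      ContDiffOn ℝ k g (P ×ˢ Icc 0 1) →
      ContDiffOn ℝ k (fun p => ∫ s in (0 : ℝ)..1, g (p, s)) P := by
  have h01 : (0 : ℝ) ≤ 1 := zero_le_one
  have hU : UniqueDiffOn ℝ (P ×ˢ Icc (0 : ℝ) 1) :=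
    hP.uniqueDiffOn.prod (uniqueDiffOn_Icc zero_lt_one)
  induction k with
  | zero =>
    intro F _ _ g hg
    simp only [Nat.cast_zero, contDiffOn_zero] at hg ⊢
    exact hg.integral_zero_one
  | succ k ih =>
    intro F _ _ g hg
    -- Smoothness of `g` is known only up to the faces `s = 0, 1`, so the partial derivative is read
    -- off from the derivative within the product.
    set g' : E × ℝ → E →L[ℝ] F := fun q =>
      (fderivWithin ℝ g (P ×ˢ Icc 0 1) q).comp (ContinuousLinearMap.inl ℝ E ℝ) with hg'
    have hg'c : ContDiffOn ℝ k g' (P ×ˢ Icc 0 1) :=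
      (hg.fderivWithin hU (by norm_cast)).clm_comp contDiffOn_const
    have hpt : ∀ p ∈ P, ∀ s ∈ Icc (0 : ℝ) 1, HasFDerivAt (fun p => g (p, s)) (g' (p, s)) p := by
      intro p hp s hs
      have h1 := (hg.differentiableOn (by simp) (p, s) ⟨hp, hs⟩).hasFDerivWithinAt
      have h2 : HasFDerivWithinAt (fun p : E => (p, s)) (ContinuousLinearMap.inl ℝ E ℝ) P p :=
        (hasFDerivAt_prodMk_left p s).hasFDerivWithinAt
      have h3 : MapsTo (fun p : E => (p, s)) P (P ×ˢ Icc (0 : ℝ) 1) := fun x hx => ⟨hx, hs⟩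
      exact (h1.comp p h2 h3).hasFDerivAt (hP.mem_nhds hp)
    have hcont : ∀ {G : Type} [NormedAddCommGroup G] (φ : E × ℝ → G),
        ContinuousOn φ (P ×ˢ Icc 0 1) → ∀ p ∈ P, ContinuousOn (fun s => φ (p, s)) (Icc 0 1) :=
      fun φ hφ p hp => hφ.comp (by fun_prop) fun s hs => ⟨hp, hs⟩
    have hd : ∀ p ∈ P, HasFDerivAt (fun p => ∫ s in (0 : ℝ)..1, g (p, s))
        (∫ s in (0 : ℝ)..1, g' (p, s)) p := by
      intro p hp
      obtain ⟨C, hCn, hCP, hCc⟩ := local_compact_nhds (hP.mem_nhds hp)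
      obtain ⟨M, hM⟩ := (hCc.prod (isCompact_Icc (a := (0 : ℝ)) (b := 1))).exists_bound_of_continuousOn
        (hg'c.continuousOn.mono (prod_mono hCP subset_rfl))
      have hm : ∀ {G : Type} [NormedAddCommGroup G] (φ : E × ℝ → G),
          ContinuousOn φ (P ×ˢ Icc 0 1) → ∀ p ∈ P,
          AEStronglyMeasurable (fun s => φ (p, s)) (volume.restrict (uIoc (0 : ℝ) 1)) := by
        intro G _ φ hφ p hp
        rw [uIoc_of_le h01]
        exact ((hcont φ hφ p hp).aestronglyMeasurable measurableSet_Icc).mono_set Ioc_subset_Icc_self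
      refine intervalIntegral.hasFDerivAt_integral_of_dominated_of_fderiv_le (bound := fun _ => M)
        (F' := fun p s => g' (p, s)) hCn ?_ ?_ (hm g' hg'c.continuousOn p hp) ?_ (by simp) ?_
      · filter_upwards [hP.mem_nhds hp] with p' hp' using hm g hg.continuousOn p' hp'
      · exact ContinuousOn.intervalIntegrable (by
          rw [uIcc_of_le h01]; exact hcont g hg.continuousOn p hp)
      · refine ae_of_all _ fun s hs x hx => hM (x, s) ⟨hx, ?_⟩
        rw [uIoc_of_le h01] at hs
        exact Ioc_subset_Icc_self hs
      · refine ae_of_all _ fun s hs x hx => hpt x (hCP hx) s ?_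
        rw [uIoc_of_le h01] at hs
        exact Ioc_subset_Icc_self hs
    have hs := contDiffOn_succ_iff_fderiv_of_isOpen (𝕜 := ℝ) (n := (k : WithTop ℕ∞))
      (f := fun p => ∫ s in (0 : ℝ)..1, g (p, s)) hP
    push_cast
    rw [hs]
    refine ⟨fun p hp => (hd p hp).differentiableAt.differentiableWithinAt, by simp, ?_⟩
    exact (ih hg'c).congr fun p hp => (hd p hp).fderiv

theorem ContDiffOn.integral_zero_one {E F : Type} [NormedAddCommGroup E] [NormedSpace ℝ E]
    [FiniteDimensional ℝ E] [NormedAddCommGroup F] [NormedSpace ℝ F] {P : Set E} (hP : IsOpen P)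
    {g : E × ℝ → F} (hg : ContDiffOn ℝ ∞ g (P ×ˢ Icc 0 1)) :
    ContDiffOn ℝ ∞ (fun p => ∫ s in (0 : ℝ)..1, g (p, s)) P :=
  contDiffOn_infty.2 fun k =>
    ContDiffOn.integral_zero_one_nat hP k (hg.of_le (by exact_mod_cast le_top))

/-- If the signed images of finitely many finite signed measures add up to zero, so do the
integrals of a bounded measurable function with respect to them. -/
theorem sum_integral_eq_zero_of_sum_setIntegral_eq_zero {Z K : Type*} [MeasurableSpace Z]
    (I : Finset K) {Ω : K → Type*} [∀ k, MeasurableSpace (Ω k)] (m : ∀ k, Measure (Ω k))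
    (p : ∀ k, Ω k → Z) (hp : ∀ k, Measurable (p k)) (g : ∀ k, Ω k → ℝ)
    (hg : ∀ k ∈ I, Integrable (g k) (m k))
    (hB : ∀ B, MeasurableSet B → ∑ k ∈ I, ∫ y in p k ⁻¹' B, g k y ∂(m k) = 0)
    (h : Z → ℝ) (hh : Measurable h) (c : ℝ) (hc : ∀ z, |h z| ≤ c) :
    ∑ k ∈ I, ∫ y, h (p k y) * g k y ∂(m k) = 0 := by
  have hint : ∀ (s : SimpleFunc Z ℝ), ∀ k ∈ I, Integrable (fun y => s (p k y) * g k y) (m k) := by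
    intro s k hk
    obtain ⟨C, hC⟩ := s.exists_forall_norm_le
    exact (hg k hk).bdd_mul (s.measurable.comp (hp k)).aestronglyMeasurable
      (ae_of_all _ fun y => hC _)
  -- Indicators are the hypothesis `hB`; simple functions follow by linearity, and bounded
  -- measurable `h` by dominated convergence.
  have hs : ∀ s : SimpleFunc Z ℝ, ∑ k ∈ I, ∫ y, s (p k y) * g k y ∂(m k) = 0 := by
    intro s
    induction s using SimpleFunc.induction with
    | const a hB' =>
      rename_i B
      have : ∀ k ∈ I, ∫ y, (SimpleFunc.piecewise B hB' (SimpleFunc.const Z a)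
          (SimpleFunc.const Z 0)) (p k y) * g k y ∂(m k) =
          a * ∫ y in p k ⁻¹' B, g k y ∂(m k) := by
        intro k hk
        rw [← integral_indicator (hp k hB'), ← integral_const_mul]
        refine integral_congr_ae (ae_of_all _ fun y => ?_)
        by_cases hy : p k y ∈ B <;> simp [hy, SimpleFunc.piecewise_apply]
      rw [Finset.sum_congr rfl this, ← Finset.mul_sum, hB B hB', mul_zero]
    | add _ hs ht =>
      rename_i s t _
      rw [← add_zero (0 : ℝ)]
      nth_rw 1 [← hs]
      rw [← ht, ← Finset.sum_add_distrib]
      refine Finset.sum_congr rfl fun k hk => ?_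
      rw [← integral_add (hint s k hk) (hint t k hk)]
      refine integral_congr_ae (ae_of_all _ fun y => ?_)
      simp [add_mul]
  have hc' : ∀ z, ‖h z‖ ≤ |c| := fun z => (hc z).trans (le_abs_self c)
  have hsm := hh.stronglyMeasurable
  have hlim : Tendsto (fun j => ∑ k ∈ I, ∫ y, hsm.approxBounded |c| j (p k y) * g k y ∂(m k)) atTop
      (𝓝 (∑ k ∈ I, ∫ y, h (p k y) * g k y ∂(m k))) := by
    refine tendsto_finsetSum _ fun k hk => ?_
    refine tendsto_integral_of_dominated_convergence (fun y => |c| * ‖g k y‖)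
      (fun j => (hint _ k hk).aestronglyMeasurable) ((hg k hk).norm.const_mul _) ?_ ?_
    · intro j
      refine ae_of_all _ fun y => ?_
      rw [norm_mul]
      exact mul_le_mul_of_nonneg_right (hsm.norm_approxBounded_le (abs_nonneg c) j _) (norm_nonneg _)
    · exact ae_of_all _ fun y => (hsm.tendsto_approxBounded_of_norm_le (hc' _)).mul_const _
  simp only [hs] at hlim
  exact tendsto_nhds_unique hlim tendsto_const_nhds |>.symm ▸ rfl

/-! ### Measurability and volume of strata. -/

theorem isAddHaarMeasure_volume_spaceTime (n : ℕ) :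
    (volume : Measure (SpaceTime n)).IsAddHaarMeasure :=
  inferInstanceAs ((volume : Measure (Space n)).prod (volume : Measure ℝ)).IsAddHaarMeasure

namespace Stratum

variable {n : ℕ} {T : ℝ}

theorem measurableSet_carrier (P : Stratum n T) : MeasurableSet P.carrier := by
  have h : P.carrier = P.dom \ (P.dom ∩ P.S ⁻¹' {0}ᶜ) := by
    ext p
    simp [carrier]
  rw [h]
  exact P.isOpen_dom.measurableSet.diff
    (P.smooth.continuousOn.isOpen_inter_preimage P.isOpen_dom isOpen_compl_singleton).measurableSet

theorem carrier_subset_strip (P : Stratum n T) : P.carrier ⊆ strip n T :=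
  fun _ hp => P.dom_subset hp.1

theorem differentiableAt (P : Stratum n T) {p : SpaceTime n} (hp : p ∈ P.dom) :
    DifferentiableAt ℝ P.S p :=
  (P.smooth.contDiffAt (P.isOpen_dom.mem_nhds hp)).differentiableAt (by simp)

/-- One component of `S` suffices. Its differential does not vanish on the stratum, so at each point
some basis direction has nonzero derivative. A line in that direction meets the corresponding part
`N i` in a countable set, and Fubini makes `N i` null. -/
theorem volume_carrier (P : Stratum n T) : volume P.carrier = 0 := by
  have := isAddHaarMeasure_volume_spaceTime n
  let b := Module.finBasis ℝ (SpaceTime n)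
  let j : Fin P.codim := ⟨0, P.one_le_codim⟩
  let N : Fin (Module.finrank ℝ (SpaceTime n)) → Set (SpaceTime n) := fun i =>
    P.carrier ∩ {p | fderiv ℝ P.S p (b i) j ≠ 0}
  have hN : ∀ i, volume (N i) = 0 := by
    intro i
    have hm : MeasurableSet (N i) := by
      refine P.measurableSet_carrier.inter ?_
      have h1 : Measurable fun p => fderiv ℝ P.S p (b i) j :=
        (EuclideanSpace.proj (𝕜 := ℝ) j).measurable.comp (measurable_fderiv_apply_const ℝ P.S (b i))
      exact h1 (measurableSet_singleton 0).compl
    have h := ae_mem_of_ae_add_linearMap_mem (LinearMap.toSpanSingleton ℝ (SpaceTime n) (b i))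
      volume volume hm.compl ?_
    · rwa [ae_iff, show {a | ¬ a ∈ (N i)ᶜ} = N i by ext; simp] at h
    intro y
    rw [ae_iff]
    refine measure_mono_null ?_
      ((countable_level_hasDerivAt_ne_zero (fun t => P.S (y + t • b i) j) 0).measure_zero volume)
    intro t ht
    simp only [LinearMap.toSpanSingleton_apply, mem_compl_iff, not_not, mem_ofPred_eq] at ht
    refine ⟨by simp [ht.1.2], _, ht.2, ?_⟩
    have h1 := (P.differentiableAt ht.1.1).hasFDerivAt
    have h2 : HasDerivAt (fun t : ℝ => y + t • b i) (b i) t := by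
      simpa using ((hasDerivAt_id t).smul_const (b i)).const_add y
    exact (EuclideanSpace.proj (𝕜 := ℝ) j).hasFDerivAt.comp_hasDerivAt t (h1.comp_hasDerivAt t h2)
  refine measure_mono_null ?_ (measure_iUnion_null hN)
  intro p hp
  by_contra hcon
  have h0 : ∀ i, fderiv ℝ P.S p (b i) j = 0 := by
    intro i
    by_contra hi
    exact hcon (mem_iUnion.2 ⟨i, hp, hi⟩)
  obtain ⟨w, hw⟩ := P.submersion p hp.1 hp.2 (EuclideanSpace.single j 1)
  have h1 : fderiv ℝ P.S p w j = 0 := by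
    have : ((EuclideanSpace.proj (𝕜 := ℝ) j).comp (fderiv ℝ P.S p) : SpaceTime n →ₗ[ℝ] ℝ) = 0 :=
      b.ext fun i => by simpa using h0 i
    exact LinearMap.congr_fun this w
  rw [hw] at h1
  simp at h1

end Stratum

section StrataUnion

variable {n : ℕ} {T : ℝ} {ι : Type*} {Γ : ι → Stratum n T}

/-- The index set may be uncountable; local finiteness writes the union as a countable one, over
integer radii and the finitely many strata that meet each ball. -/
theorem measurableSet_strataUnion
    (h : ∀ r : ℝ, {i | ((Γ i).carrier ∩ Metric.closedBall 0 r).Nonempty}.Finite) :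
    MeasurableSet (strataUnion Γ) ∧ volume (strataUnion Γ) = 0 := by
  have hU : strataUnion Γ = ⋃ k : ℕ, ⋃ i ∈ {i | ((Γ i).carrier ∩
      Metric.closedBall 0 (k : ℝ)).Nonempty}, (Γ i).carrier := by
    ext p
    simp only [strataUnion, mem_iUnion, mem_ofPred_eq, exists_prop]
    constructor
    · rintro ⟨i, hi⟩
      obtain ⟨k, hk⟩ := exists_nat_ge ‖p‖
      exact ⟨k, i, ⟨p, hi, mem_closedBall_zero_iff.2 hk⟩, hi⟩
    · rintro ⟨k, i, _, hi⟩
      exact ⟨i, hi⟩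
  rw [hU]
  refine ⟨MeasurableSet.iUnion fun k => MeasurableSet.biUnion (h k).countable fun i _ =>
    (Γ i).measurableSet_carrier, measure_iUnion_null fun k => ?_⟩
  exact (measure_biUnion_null_iff (h k).countable).2 fun i _ => (Γ i).volume_carrier

theorem strataUnion_sumElim {κ : Type*} {J : κ → Stratum n T} :
    strataUnion (Sum.elim Γ J) = strataUnion Γ ∪ strataUnion J := by
  ext p
  simp [strataUnion]

theorem isOpen_strip (n : ℕ) (T : ℝ) : IsOpen (strip n T) :=
  (isOpen_lt continuous_const continuous_snd).inter (isOpen_lt continuous_snd continuous_const)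

theorem IsStratified.finite_left {κ : Type*} {J : κ → Stratum n T}
    (h : IsStratified (Sum.elim Γ J)) (r : ℝ) :
    {i | ((Γ i).carrier ∩ Metric.closedBall 0 r).Nonempty}.Finite :=
  (h.locallyFinite r).preimage (f := Sum.inl) Sum.inl_injective.injOn

theorem IsStratified.finite_right {κ : Type*} {J : κ → Stratum n T}
    (h : IsStratified (Sum.elim Γ J)) (r : ℝ) :
    {i | ((J i).carrier ∩ Metric.closedBall 0 r).Nonempty}.Finite :=
  (h.locallyFinite r).preimage (f := Sum.inr) Sum.inr_injective.injOn

end StrataUnion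

/-! ### Ramp functions around a stratum. -/

noncomputable section

namespace Stratum

variable {n : ℕ} {T : ℝ}

/-- The function `min (|S| / ε) 1` on the domain of the stratum, extended by zero. -/
def ramp (P : Stratum n T) (ε : ℝ) : SpaceTime n → ℝ :=
  P.dom.indicator fun p => min (‖P.S p‖ / ε) 1

/-- The differential of `ζ * P.ramp ε` off the set `{|S| = ε}`. -/
def rampCovector (P : Stratum n T) (ε : ℝ) (ζ : SpaceTime n → ℝ) (p : SpaceTime n) :
    SpaceTime n →L[ℝ] ℝ :=
  P.ramp ε p • fderiv ℝ ζ p +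
    (P.tube ε).indicator (fun p => (ζ p * ε⁻¹) • fderiv ℝ (fun q => ‖P.S q‖) p) p

theorem ramp_nonneg (P : Stratum n T) {ε : ℝ} (hε : 0 < ε) (p : SpaceTime n) : 0 ≤ P.ramp ε p :=
  indicator_nonneg (fun _ _ => le_min (by positivity) zero_le_one) p

theorem ramp_le_one (P : Stratum n T) (ε : ℝ) (p : SpaceTime n) : P.ramp ε p ≤ 1 :=
  indicator_le' (fun _ _ => min_le_right _ _) (fun _ _ => zero_le_one) p

theorem continuousOn_ramp (P : Stratum n T) (ε : ℝ) : ContinuousOn (P.ramp ε) P.dom := by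
  have h : ContinuousOn (fun p => min (‖P.S p‖ / ε) 1) P.dom :=
    ContinuousOn.inf (P.smooth.continuousOn.norm.div_const ε) continuousOn_const
  exact h.congr fun p hp => indicator_of_mem hp _

theorem measurable_ramp (P : Stratum n T) (ε : ℝ) : Measurable (P.ramp ε) := by
  classical
  have h := (P.continuousOn_ramp ε).measurable_piecewise
    (continuousOn_const (c := (0 : ℝ)) (s := P.domᶜ)) P.isOpen_dom.measurableSet
  convert h using 1
  ext p
  by_cases hp : p ∈ P.dom <;> simp [ramp, hp]

theorem tendsto_ramp (P : Stratum n T) (p : SpaceTime n) :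
    Tendsto (fun ε => P.ramp ε p) (𝓝[>] 0) (𝓝 ((P.dom \ P.carrier).indicator 1 p)) := by
  by_cases hp : p ∈ P.dom
  · by_cases hS : P.S p = 0
    · have : p ∈ P.carrier := ⟨hp, hS⟩
      simp [ramp, hp, hS, this]
    · have : p ∉ P.carrier := fun h => hS h.2
      have hd : p ∈ P.dom \ P.carrier := ⟨hp, this⟩
      rw [indicator_of_mem hd, Pi.one_apply]
      refine tendsto_const_nhds.congr' ?_
      filter_upwards [Ioo_mem_nhdsGT (norm_pos_iff.2 hS)] with ε hε
      rw [ramp, indicator_of_mem hp, min_eq_right]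
      rw [one_le_div hε.1]
      exact hε.2.le
  · simp [ramp, hp]

theorem isOpen_tube (P : Stratum n T) (ε : ℝ) : IsOpen (P.tube ε) := by
  have h := P.smooth.continuousOn.norm.isOpen_inter_preimage P.isOpen_dom
    (isOpen_Ioo (a := (0 : ℝ)) (b := ε))
  exact h

theorem hasFDerivAt_norm (P : Stratum n T) {p : SpaceTime n} (hp : p ∈ P.dom) (h0 : P.S p ≠ 0) :
    HasFDerivAt (fun q => ‖P.S q‖) (fderiv ℝ (fun q => ‖P.S q‖) p) p :=
  ((P.differentiableAt hp).norm ℝ h0).hasFDerivAt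

theorem norm_fderiv_norm_le (P : Stratum n T) {p : SpaceTime n} (hp : p ∈ P.dom)
    (h0 : P.S p ≠ 0) : ‖fderiv ℝ (fun q => ‖P.S q‖) p‖ ≤ ‖fderiv ℝ P.S p‖ := by
  have h1 : DifferentiableAt ℝ (fun z : EuclideanSpace ℝ (Fin P.codim) => ‖z‖) (P.S p) :=
    differentiableAt_id.norm ℝ h0
  have h2 := fderiv_comp p h1 (P.differentiableAt hp)
  have h3 : (fun q => ‖P.S q‖) =
    (fun z : EuclideanSpace ℝ (Fin P.codim) => ‖z‖) ∘ P.S := rfl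
  rw [h3, h2]
  refine (ContinuousLinearMap.opNorm_comp_le _ _).trans ?_
  have h4 := norm_fderiv_le_of_lipschitz ℝ (x₀ := P.S p)
    (lipschitzWith_one_norm (E := EuclideanSpace ℝ (Fin P.codim)))
  calc _ ≤ ((1 : NNReal) : ℝ) * ‖fderiv ℝ P.S p‖ := by gcongr
    _ = _ := by simp

/-- The ramp has a kink on `{|S| = ε}`. The excluded times are the transversal crossings of this
level, which are countable by `countable_level_hasDerivAt_ne_zero`; a tangential contact is
harmless. -/
theorem hasDerivAt_ramp (P : Stratum n T) {ε : ℝ} (hε : 0 < ε) {q : ℝ → SpaceTime n}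
    {q' : SpaceTime n} {t : ℝ} (hq : HasDerivAt q q' t) (hmem : q t ∈ P.dom) (h0 : P.S (q t) ≠ 0)
    (hs : ¬ (‖P.S (q t)‖ = ε ∧ ∃ g' : ℝ, g' ≠ 0 ∧ HasDerivAt (fun s => ‖P.S (q s)‖) g' t)) :
    HasDerivAt (fun s => P.ramp ε (q s))
      ((P.tube ε).indicator (fun p => ε⁻¹ * fderiv ℝ (fun q => ‖P.S q‖) p q') (q t)) t := by
  have hS : HasDerivAt (fun s => ‖P.S (q s)‖) (fderiv ℝ (fun q => ‖P.S q‖) (q t) q') t :=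
    (P.hasFDerivAt_norm hmem h0).comp_hasDerivAt t hq
  set g : ℝ → ℝ := fun s => ‖P.S (q s)‖ with hg
  have hev : (fun s => P.ramp ε (q s)) =ᶠ[𝓝 t] fun s => min (g s / ε) 1 := by
    filter_upwards [hq.continuousAt.preimage_mem_nhds (P.isOpen_dom.mem_nhds hmem)] with s hs
    exact indicator_of_mem (show q s ∈ P.dom from hs) fun p => min (‖P.S p‖ / ε) 1
  refine HasDerivAt.congr_of_eventuallyEq ?_ hev
  have hc : ContinuousAt g t := hS.continuousAt
  rcases lt_trichotomy (g t) ε with hlt | heq | hgt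
  · have ht : q t ∈ P.tube ε := ⟨hmem, norm_pos_iff.2 h0, hlt⟩
    rw [indicator_of_mem ht]
    have h1 : (fun s => min (g s / ε) 1) =ᶠ[𝓝 t] fun s => ε⁻¹ * g s := by
      filter_upwards [hc.eventually_lt_const hlt] with s hs
      rw [min_eq_left ((div_le_one hε).2 hs.le), div_eq_inv_mul]
    exact (hS.const_mul ε⁻¹).congr_of_eventuallyEq h1
  · have ht : q t ∉ P.tube ε := fun h => h.2.2.ne heq
    rw [indicator_of_notMem ht]
    have hz : HasDerivAt g 0 t := by
      by_contra hcon
      refine hs ⟨heq, _, fun h => hcon ?_, hS⟩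
      rwa [h] at hS
    have h1 : HasDerivAt (fun s => g s / ε) 0 t := by simpa using hz.div_const ε
    rw [hasDerivAt_iff_isLittleO] at h1 ⊢
    -- `min (·) 1` is 1-Lipschitz, so a vanishing derivative of `g / ε` at the kink is inherited by
    -- the ramp.
    refine (Asymptotics.isBigO_of_le _ fun s => ?_).trans_isLittleO h1
    simp only [smul_zero, sub_zero]
    rw [heq, div_self hε.ne', min_self]
    have := abs_min_sub_min_le_max (g s / ε) 1 1 1
    simpa using this
  · have ht : q t ∉ P.tube ε := fun h => h.2.2.not_gt hgt
    rw [indicator_of_notMem ht]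
    have h1 : (fun s => min (g s / ε) 1) =ᶠ[𝓝 t] fun _ => (1 : ℝ) := by
      filter_upwards [hc.eventually_const_lt hgt] with s hs
      rw [min_eq_right ((one_le_div hε).2 hs.le)]
    exact (hasDerivAt_const t (1 : ℝ)).congr_of_eventuallyEq h1

theorem hasDerivAt_mul_ramp (P : Stratum n T) {ε : ℝ} (hε : 0 < ε) {ζ : SpaceTime n → ℝ}
    (hζ : ContDiff ℝ ∞ ζ) (hsupp : tsupport ζ ⊆ P.dom) {q : ℝ → SpaceTime n}
    {q' : SpaceTime n} {t : ℝ} (hq : HasDerivAt q q' t) (hmem : q t ∉ P.carrier)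
    (hs : ¬ (‖P.S (q t)‖ = ε ∧ ∃ g' : ℝ, g' ≠ 0 ∧ HasDerivAt (fun s => ‖P.S (q s)‖) g' t)) :
    HasDerivAt (fun s => ζ (q s) * P.ramp ε (q s)) (P.rampCovector ε ζ (q t) q') t := by
  by_cases hts : q t ∈ tsupport ζ
  · have hd := hsupp hts
    have h0 : P.S (q t) ≠ 0 := fun h => hmem ⟨hd, h⟩
    have h1 : HasDerivAt (fun s => ζ (q s)) (fderiv ℝ ζ (q t) q') t :=
      ((hζ.differentiable (by simp)) (q t)).hasFDerivAt.comp_hasDerivAt t hq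
    refine (h1.fun_mul (P.hasDerivAt_ramp hε hq hd h0 hs)).congr_deriv ?_
    by_cases ht : q t ∈ P.tube ε
    · simp [rampCovector, ht]; ring
    · simp [rampCovector, ht]; ring
  · have hz : ∀ᶠ s in 𝓝 t, ζ (q s) = 0 := by
      filter_upwards [hq.continuousAt.preimage_mem_nhds
        ((isClosed_tsupport ζ).isOpen_compl.mem_nhds hts)] with s hs
      exact image_eq_zero_of_notMem_tsupport hs
    have hf : fderiv ℝ ζ (q t) = 0 := by
      by_contra h
      exact hts (tsupport_fderiv_subset ℝ (subset_tsupport _ h))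
    have hcov : P.rampCovector ε ζ (q t) q' = 0 := by
      by_cases ht : q t ∈ P.tube ε <;>
        simp [rampCovector, ht, hf, image_eq_zero_of_notMem_tsupport hts]
    rw [hcov]
    refine (hasDerivAt_const t (0 : ℝ)).congr_of_eventuallyEq ?_
    filter_upwards [hz] with s hs
    simp [hs]

theorem continuous_mul_ramp (P : Stratum n T) (ε : ℝ) {ζ : SpaceTime n → ℝ}
    (hζ : Continuous ζ) (hsupp : tsupport ζ ⊆ P.dom) :
    Continuous fun p => ζ p * P.ramp ε p :=
  (hζ.continuousOn.mul (P.continuousOn_ramp ε)).continuous_of_tsupport_subset P.isOpen_dom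
    ((tsupport_mul_subset_left (f := ζ) (g := P.ramp ε)).trans hsupp)

theorem measurable_rampCovector (P : Stratum n T) (ε : ℝ) {ζ : SpaceTime n → ℝ}
    (hζ : Continuous ζ) : Measurable (P.rampCovector ε ζ) := by
  refine Measurable.add ((P.measurable_ramp ε).smul (measurable_fderiv ℝ ζ)) ?_
  refine Measurable.indicator ?_ (P.isOpen_tube ε).measurableSet
  exact (hζ.measurable.mul_const _).smul (measurable_fderiv ℝ _)

/-- The derivative of `|S|` is undefined on the stratum, but off it is bounded by that of `S`, which
is continuous on the compact support of `ζ`. The bound may depend on `ε`: it serves integrability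
only. -/
theorem exists_norm_rampCovector_le (P : Stratum n T) {ε : ℝ} (hε : 0 < ε) {ζ : SpaceTime n → ℝ}
    (hζ : ContDiff ℝ ∞ ζ) (hc : HasCompactSupport ζ) (hsupp : tsupport ζ ⊆ P.dom) :
    ∃ C, ∀ p, ‖P.rampCovector ε ζ p‖ ≤ C := by
  obtain ⟨C₁, h₁⟩ := (hζ.continuous_fderiv (by simp)).bounded_above_of_compact_support (hc.fderiv ℝ)
  have hS : ContinuousOn (fun p => (ζ p * ε⁻¹) • fderiv ℝ P.S p) P.dom :=
    (hζ.continuous.mul continuous_const).continuousOn.smul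
      (P.smooth.continuousOn_fderiv_of_isOpen P.isOpen_dom (by simp))
  obtain ⟨C₂, h₂⟩ := hc.isCompact.exists_bound_of_continuousOn (hS.mono hsupp)
  have hC₂ : 0 ≤ max C₂ 0 := le_max_right _ _
  refine ⟨C₁ + max C₂ 0, fun p => (norm_add_le _ _).trans (add_le_add ?_ ?_)⟩
  · rw [norm_smul, Real.norm_of_nonneg (P.ramp_nonneg hε p)]
    exact (mul_le_of_le_one_left (norm_nonneg _) (P.ramp_le_one ε p)).trans (h₁ p)
  · by_cases ht : p ∈ P.tube ε
    · rw [indicator_of_mem ht]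
      by_cases hts : p ∈ tsupport ζ
      · refine le_trans ?_ ((h₂ p hts).trans (le_max_left _ _))
        rw [norm_smul, norm_smul]
        gcongr
        exact P.norm_fderiv_norm_le ht.1 (norm_pos_iff.1 ht.2.1)
      · rw [image_eq_zero_of_notMem_tsupport hts]
        simp
    · rw [indicator_of_notMem ht]
      simp

end Stratum

/-! ### Sweeps, their balance law, and their flux into a stratum. -/

/-- A mass carried along the trajectories `t ↦ (path y t, t)`, `start y < t < finish y`, of a
velocity field `V`. The measure `σ` is swept out by the trajectories with the density `weight` with
respect to `dt dν`, the mass has the density `e` with respect to `σ`, and its amplitude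
`amp = weight * e` solves a linear transport equation with coefficient `c` and source `F`. -/
structure Sweep (n : ℕ) (Y : Type*) [MeasurableSpace Y] where
  ν : Measure Y
  sigmaFinite : SigmaFinite ν
  σ : Measure (SpaceTime n)
  V : SpaceTime n → Space n
  c : SpaceTime n → ℝ
  e : SpaceTime n → ℝ
  F : SpaceTime n → ℝ
  start : Y → ℝ
  finish : Y → ℝ
  path : Y → ℝ → Space n
  amp : Y → ℝ → ℝ
  weight : Y × ℝ → ℝ
  measurableSet : MeasurableSet {z : Y × ℝ | z.2 ∈ Ioo (start z.1) (finish z.1)}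
  start_le : ∀ᵐ y ∂ν, start y ≤ finish y
  integrable_comp : ∀ G : SpaceTime n → ℝ, Integrable G σ →
    IntegrableOn (fun z : Y × ℝ => weight z * G (path z.1 z.2, z.2))
      {z | z.2 ∈ Ioo (start z.1) (finish z.1)} (ν.prod volume)
  integral_comp : ∀ G : SpaceTime n → ℝ, Integrable G σ → ∫ p, G p ∂σ =
    ∫ z in {z : Y × ℝ | z.2 ∈ Ioo (start z.1) (finish z.1)},
      weight z * G (path z.1 z.2, z.2) ∂(ν.prod volume)
  amp_eq : ∀ᵐ y ∂ν, ∀ t ∈ Ioo (start y) (finish y), amp y t = weight (y, t) * e (path y t, t)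
  continuousOn_path : ∀ᵐ y ∂ν, ContinuousOn (path y) (Icc (start y) (finish y))
  continuousOn_amp : ∀ᵐ y ∂ν, ContinuousOn (amp y) (Icc (start y) (finish y))
  hasDerivAt_path : ∀ᵐ y ∂ν, ∀ t ∈ Ioo (start y) (finish y),
    HasDerivAt (path y) (V (path y t, t)) t
  hasDerivAt_amp : ∀ᵐ y ∂ν, ∀ t ∈ Ioo (start y) (finish y),
    HasDerivAt (amp y) (weight (y, t) * F (path y t, t) - c (path y t, t) * amp y t) t
  locInt_density : LocInt e σ
  locInt_flux : LocInt (fun p => e p • V p) σ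
  locInt_damping : LocInt (fun p => c p * e p) σ
  locInt_source : LocInt F σ
  aemeasurable_start : AEMeasurable (fun y => (path y (start y), start y)) ν
  aemeasurable_finish : AEMeasurable (fun y => (path y (finish y), finish y)) ν

theorem LocInt.integrable_mul {n : ℕ} {g φ : SpaceTime n → ℝ} {σ : Measure (SpaceTime n)}
    (hg : LocInt g σ) (hφ : Measurable φ) {C r : ℝ} (hC : ∀ p, |φ p| ≤ C)
    (hr : ∀ p, p ∉ Metric.closedBall (0 : SpaceTime n) r → φ p = 0) :
    Integrable (fun p => g p * φ p) σ := by
  have h1 : IntegrableOn (fun p => g p * φ p) (Metric.closedBall 0 r) σ :=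
    (hg r).mul_bdd hφ.aestronglyMeasurable (ae_of_all _ hC)
  refine (integrableOn_iff_integrable_of_support_subset fun p hp => ?_).1 h1
  by_contra hcon
  exact hp (by simp [hr p hcon])

theorem HasCompactSupport.exists_closedBall {n : ℕ} {φ : SpaceTime n → ℝ}
    (hφ : HasCompactSupport φ) :
    ∃ r : ℝ, ∀ p, p ∉ Metric.closedBall (0 : SpaceTime n) r → p ∉ tsupport φ := by
  obtain ⟨r, hr⟩ := hφ.isCompact.isBounded.subset_closedBall 0
  exact ⟨r, fun p hp h => hp (hr h)⟩

theorem LocInt.integrable_mul_of_hasCompactSupport {n : ℕ} {g φ : SpaceTime n → ℝ}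
    {σ : Measure (SpaceTime n)} (hg : LocInt g σ) (hφ : Continuous φ) (hc : HasCompactSupport φ) :
    Integrable (fun p => g p * φ p) σ := by
  obtain ⟨C, hC⟩ := hφ.bounded_above_of_compact_support hc
  obtain ⟨r, hr⟩ := hc.exists_closedBall
  exact hg.integrable_mul hφ.measurable hC fun p hp =>
    image_eq_zero_of_notMem_tsupport (hr p hp)

/-- Moving `e` inside the linear form gives `lam (e V, e)`, which involves only the locally
integrable `e` and `e V`. -/
theorem LocInt.integrable_covector {n : ℕ} {e : SpaceTime n → ℝ} {V : SpaceTime n → Space n}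
    {σ : Measure (SpaceTime n)} (he : LocInt e σ) (hV : LocInt (fun p => e p • V p) σ)
    {lam : SpaceTime n → SpaceTime n →L[ℝ] ℝ} (hl : Measurable lam) {C r : ℝ}
    (hC : ∀ p, ‖lam p‖ ≤ C)
    (hr : ∀ p, p ∉ Metric.closedBall (0 : SpaceTime n) r → lam p = 0) :
    Integrable (fun p => e p * lam p (V p, 1)) σ := by
  have h0 : (fun p => e p * lam p (V p, 1)) = fun p => lam p (e p • V p, e p) := by
    funext p
    rw [← smul_eq_mul, ← map_smul]
    simp
  have h1 : IntegrableOn (fun p => lam p (e p • V p, e p)) (Metric.closedBall 0 r) σ := by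
    have h2 := (hV r).prodMk (he r)
    refine (h2.norm.const_mul C).mono' ?_ (ae_of_all _ fun p => ?_)
    · exact (ContinuousLinearMap.id ℝ (SpaceTime n →L[ℝ] ℝ)).aestronglyMeasurable_comp₂
        hl.aestronglyMeasurable h2.aestronglyMeasurable
    · exact (lam p).le_of_opNorm_le (hC p) _
  rw [h0]
  refine (integrableOn_iff_integrable_of_support_subset fun p hp => ?_).1 h1
  by_contra hcon
  exact hp (by simp [hr p hcon])

namespace Sweep

variable {n : ℕ} {T : ℝ} {Y : Type*} [MeasurableSpace Y] (A : Sweep n Y)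

/-- The amplitude tested with `φ` at the end point of a trajectory. -/
def outflow (φ : SpaceTime n → ℝ) (y : Y) : ℝ :=
  A.amp y (A.finish y) * φ (A.path y (A.finish y), A.finish y)

/-- The amplitude tested with `φ` at the initial point of a trajectory. -/
def inflow (φ : SpaceTime n → ℝ) (y : Y) : ℝ :=
  A.amp y (A.start y) * φ (A.path y (A.start y), A.start y)

/-- The total increment of the amplitude tested with `φ`. -/
def boundary (φ : SpaceTime n → ℝ) : ℝ :=
  ∫ y, (A.outflow φ y - A.inflow φ y) ∂A.ν

/-- On each curve `amp · φ` is continuous up to the end points and has the stated integrand, times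
`weight`, as derivative off a countable set; the fundamental theorem of calculus and Fubini do the
rest. The covector `lam` has to be the derivative of `φ` only along the curves, off countably many
times, which admits `φ = ζ · ramp`. -/
theorem integral_eq_boundary {φ : SpaceTime n → ℝ} (hφ : Continuous φ)
    {lam : SpaceTime n → SpaceTime n →L[ℝ] ℝ}
    (hd : ∀ᵐ y ∂A.ν, ∃ s : Set ℝ, s.Countable ∧ ∀ t ∈ Ioo (A.start y) (A.finish y) \ s,
      HasDerivAt (fun t => φ (A.path y t, t)) (lam (A.path y t, t) (A.V (A.path y t, t), 1)) t)
    (h1 : Integrable (fun p => A.e p * lam p (A.V p, 1)) A.σ)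
    (h2 : Integrable (fun p => A.c p * A.e p * φ p) A.σ)
    (h3 : Integrable (fun p => A.F p * φ p) A.σ) :
    Integrable (fun y => A.outflow φ y - A.inflow φ y) A.ν ∧
      ∫ p, (A.e p * lam p (A.V p, 1) - A.c p * A.e p * φ p + A.F p * φ p) ∂A.σ =
        A.boundary φ := by
  have := A.sigmaFinite
  set G : SpaceTime n → ℝ := fun p =>
    A.e p * lam p (A.V p, 1) - A.c p * A.e p * φ p + A.F p * φ p with hG
  have hGi : Integrable G A.σ := (h1.sub h2).add h3
  set Ω : Set (Y × ℝ) := {z | z.2 ∈ Ioo (A.start z.1) (A.finish z.1)} with hΩ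
  set g : Y × ℝ → ℝ := fun z => A.weight z * G (A.path z.1 z.2, z.2) with hg
  have hgi : Integrable (Ω.indicator g) (A.ν.prod volume) :=
    (A.integrable_comp G hGi).integrable_indicator A.measurableSet
  have key : ∀ᵐ y ∂A.ν, ∫ t, Ω.indicator g (y, t) = A.outflow φ y - A.inflow φ y := by
    filter_upwards [hgi.prod_right_ae, hd, A.start_le, A.amp_eq, A.continuousOn_path,
      A.continuousOn_amp, A.hasDerivAt_amp] with y hy hdy hle hamp hcp hca hda
    obtain ⟨s, hs, hds⟩ := hdy
    have hind : (fun t => Ω.indicator g (y, t)) =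
        (Ioo (A.start y) (A.finish y)).indicator fun t => g (y, t) := by
      funext t
      by_cases ht : t ∈ Ioo (A.start y) (A.finish y)
      · rw [indicator_of_mem ht, indicator_of_mem (show (y, t) ∈ Ω from ht)]
      · rw [indicator_of_notMem ht, indicator_of_notMem (show (y, t) ∉ Ω from ht)]
    rw [hind] at hy ⊢
    rw [integrable_indicator_iff measurableSet_Ioo] at hy
    rw [integral_indicator measurableSet_Ioo, ← integral_Ioc_eq_integral_Ioo,
      ← intervalIntegral.integral_of_le hle]
    have hii : IntervalIntegrable (fun t => g (y, t)) volume (A.start y) (A.finish y) := by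
      rw [intervalIntegrable_iff_integrableOn_Ioo_of_le hle]
      exact hy
    refine integral_eq_of_hasDerivAt_off_countable_of_le
      (fun t => A.amp y t * φ (A.path y t, t)) (fun t => g (y, t)) hle hs ?_ ?_ hii
    · exact hca.mul (hφ.comp_continuousOn (hcp.prodMk continuousOn_id))
    · intro t ht
      refine ((hda t ht.1).fun_mul (hds t ht)).congr_deriv ?_
      simp only [hg, hG, hamp t ht.1]
      ring
  have hint := hgi.integral_prod_left
  refine ⟨hint.congr key, ?_⟩
  rw [A.integral_comp G hGi, ← integral_indicator A.measurableSet, integral_prod _ hgi]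
  exact integral_congr_ae key

/-- The balance of the mass tested with a smooth function. -/
theorem integral_fderiv_eq_boundary {ζ : SpaceTime n → ℝ} (hζ : ContDiff ℝ ∞ ζ)
    (hc : HasCompactSupport ζ) :
    Integrable (fun p => A.e p * fderiv ℝ ζ p (A.V p, 1)) A.σ ∧
    Integrable (fun p => A.c p * A.e p * ζ p) A.σ ∧
    Integrable (fun p => A.F p * ζ p) A.σ ∧
    Integrable (fun y => A.outflow ζ y - A.inflow ζ y) A.ν ∧
      ∫ p, (A.e p * fderiv ℝ ζ p (A.V p, 1) - A.c p * A.e p * ζ p + A.F p * ζ p) ∂A.σ =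
        A.boundary ζ := by
  have hcf : Continuous (fderiv ℝ ζ) := hζ.continuous_fderiv (by simp)
  obtain ⟨C, hC⟩ := hcf.bounded_above_of_compact_support (hc.fderiv ℝ)
  obtain ⟨r, hr⟩ := hc.exists_closedBall
  have h1 := A.locInt_density.integrable_covector A.locInt_flux hcf.measurable hC (r := r)
    fun p hp => image_eq_zero_of_notMem_tsupport fun h =>
      hr p hp (tsupport_fderiv_subset ℝ h)
  have h2 := A.locInt_damping.integrable_mul_of_hasCompactSupport hζ.continuous hc
  have h3 := A.locInt_source.integrable_mul_of_hasCompactSupport hζ.continuous hc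
  refine ⟨h1, h2, h3, A.integral_eq_boundary hζ.continuous ?_ h1 h2 h3⟩
  filter_upwards [A.hasDerivAt_path] with y hy
  refine ⟨∅, countable_empty, fun t ht => ?_⟩
  exact ((hζ.differentiable (by simp)) _).hasFDerivAt.comp_hasDerivAt t
    ((hy t ht.1).prodMk (hasDerivAt_id t))

theorem integrable_outflow_mul {φ h : SpaceTime n → ℝ} (hφ : Integrable (A.outflow φ) A.ν)
    (hh : Measurable h) {C : ℝ} (hC : ∀ p, |h p| ≤ C) :
    Integrable (A.outflow fun p => φ p * h p) A.ν := by
  have : (A.outflow fun p => φ p * h p) = fun y => A.outflow φ y *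
      h (A.path y (A.finish y), A.finish y) := by
    funext y
    simp only [outflow]
    ring
  rw [this]
  exact hφ.mul_bdd (hh.comp_aemeasurable A.aemeasurable_finish).aestronglyMeasurable
    (ae_of_all _ fun y => hC _)

theorem integrable_inflow_mul {φ h : SpaceTime n → ℝ} (hφ : Integrable (A.inflow φ) A.ν)
    (hh : Measurable h) {C : ℝ} (hC : ∀ p, |h p| ≤ C) :
    Integrable (A.inflow fun p => φ p * h p) A.ν := by
  have : (A.inflow fun p => φ p * h p) = fun y => A.inflow φ y *
      h (A.path y (A.start y), A.start y) := by
    funext y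
    simp only [inflow]
    ring
  rw [this]
  exact hφ.mul_bdd (hh.comp_aemeasurable A.aemeasurable_start).aestronglyMeasurable
    (ae_of_all _ fun y => hC _)

/-- Dominated convergence for the boundary terms. -/
theorem tendsto_boundary {β : Type*} {l : Filter β} [l.IsCountablyGenerated]
    {φ : SpaceTime n → ℝ} (ho : Integrable (A.outflow φ) A.ν) (hi : Integrable (A.inflow φ) A.ν)
    {h : β → SpaceTime n → ℝ} {g : SpaceTime n → ℝ} (hm : ∀ᶠ k in l, Measurable (h k))
    (hb : ∀ᶠ k in l, ∀ p, |h k p| ≤ 1)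
    (hlim : ∀ p, Tendsto (fun k => φ p * h k p) l (𝓝 (φ p * g p))) :
    Tendsto (fun k => A.boundary fun p => φ p * h k p) l
      (𝓝 (A.boundary fun p => φ p * g p)) := by
  refine tendsto_integral_filter_of_dominated_convergence
    (fun y => ‖A.outflow φ y‖ + ‖A.inflow φ y‖) ?_ ?_ (ho.norm.add hi.norm) ?_
  · filter_upwards [hm, hb] with k hk hk'
    exact ((A.integrable_outflow_mul ho hk hk').sub
      (A.integrable_inflow_mul hi hk hk')).aestronglyMeasurable
  · filter_upwards [hb] with k hk
    refine ae_of_all _ fun y => (norm_sub_le _ _).trans (add_le_add ?_ ?_)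
    · simp only [outflow]
      rw [← mul_assoc, norm_mul]
      exact mul_le_of_le_one_right (norm_nonneg _) (hk _)
    · simp only [inflow]
      rw [← mul_assoc, norm_mul]
      exact mul_le_of_le_one_right (norm_nonneg _) (hk _)
  · refine ae_of_all _ fun y => ?_
    exact ((hlim _).const_mul _).sub ((hlim _).const_mul _)

theorem boundary_add {φ ψ : SpaceTime n → ℝ} (ho : Integrable (A.outflow φ) A.ν)
    (hi : Integrable (A.inflow φ) A.ν) (ho' : Integrable (A.outflow ψ) A.ν)
    (hi' : Integrable (A.inflow ψ) A.ν) :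
    A.boundary (fun p => φ p + ψ p) = A.boundary φ + A.boundary ψ := by
  have h1 : Integrable (fun y => A.outflow φ y - A.inflow φ y) A.ν := ho.sub hi
  have h2 : Integrable (fun y => A.outflow ψ y - A.inflow ψ y) A.ν := ho'.sub hi'
  rw [boundary, boundary, boundary, ← integral_add h1 h2]
  refine integral_congr_ae (ae_of_all _ fun y => ?_)
  simp only [outflow, inflow]
  ring

/-- The mass carried by the sweep into the shrinking tubes around a stratum which its trajectories
avoid is the increment of the amplitude on the trajectories ending or starting on the stratum. -/
theorem tendsto_tube_flux (P : Stratum n T) {ζ : SpaceTime n → ℝ} (hζ : ContDiff ℝ ∞ ζ)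
    (hc : HasCompactSupport ζ) (hsupp : tsupport ζ ⊆ P.dom)
    (havoid : ∀ᵐ y ∂A.ν, ∀ t ∈ Ioo (A.start y) (A.finish y), (A.path y t, t) ∉ P.carrier)
    (hnull : A.σ P.carrier = 0)
    (ho : Integrable (A.outflow ζ) A.ν) (hi : Integrable (A.inflow ζ) A.ν) :
    Tendsto (fun ε : ℝ => -(ε⁻¹ * ∫ p in P.tube ε,
        ζ p * A.e p * fderiv ℝ (fun q => ‖P.S q‖) p (A.V p, 1) ∂A.σ)) (𝓝[>] 0)
      (𝓝 (A.boundary fun p => ζ p * P.carrier.indicator 1 p)) := by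
  obtain ⟨r, hr⟩ := hc.exists_closedBall
  obtain ⟨i1, i2, i3, -, hbal⟩ := A.integral_fderiv_eq_boundary hζ hc
  set G : SpaceTime n → ℝ := fun p =>
    A.e p * fderiv ℝ ζ p (A.V p, 1) - A.c p * A.e p * ζ p + A.F p * ζ p with hG
  have hGi : Integrable G A.σ := (i1.sub i2).add i3
  have hramp : ∀ ε > 0, ∀ p, |P.ramp ε p| ≤ 1 := fun ε hε p => by
    rw [abs_of_nonneg (P.ramp_nonneg hε p)]
    exact P.ramp_le_one ε p
  -- The balance for `ζ · ramp` is subtracted from the ramp times the integrand for `ζ`. All terms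
  -- cancel except the one in which the derivative falls on the ramp.
  have hstep : ∀ ε > 0, -(ε⁻¹ * ∫ p in P.tube ε,
        ζ p * A.e p * fderiv ℝ (fun q => ‖P.S q‖) p (A.V p, 1) ∂A.σ) =
      ∫ p, P.ramp ε p * G p ∂A.σ - A.boundary fun p => ζ p * P.ramp ε p := by
    intro ε hε
    have hφ := P.continuous_mul_ramp ε hζ.continuous hsupp
    have hφc : HasCompactSupport fun p => ζ p * P.ramp ε p := hc.mul_right
    obtain ⟨C, hC⟩ := P.exists_norm_rampCovector_le hε hζ hc hsupp
    have h1 := A.locInt_density.integrable_covector A.locInt_flux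
      (P.measurable_rampCovector ε hζ.continuous) hC (r := r) fun p hp => by
        have h := hr p hp
        have hf : fderiv ℝ ζ p = 0 := image_eq_zero_of_notMem_tsupport fun h' =>
          h (tsupport_fderiv_subset ℝ h')
        by_cases ht : p ∈ P.tube ε <;>
          simp [Stratum.rampCovector, ht, hf, image_eq_zero_of_notMem_tsupport h]
    have h2 := A.locInt_damping.integrable_mul_of_hasCompactSupport hφ hφc
    have h3 := A.locInt_source.integrable_mul_of_hasCompactSupport hφ hφc
    have hb := (A.integral_eq_boundary hφ (lam := P.rampCovector ε ζ) (by
      filter_upwards [havoid, A.hasDerivAt_path] with y hy hy'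
      refine ⟨_, countable_level_hasDerivAt_ne_zero (fun t => ‖P.S (A.path y t, t)‖) ε,
        fun t ht => ?_⟩
      exact P.hasDerivAt_mul_ramp hε hζ hsupp ((hy' t ht.1).prodMk (hasDerivAt_id t))
        (hy t ht.1) ht.2) h1 h2 h3).2
    rw [← hb]
    have hint : Integrable (fun p => P.ramp ε p * G p) A.σ :=
      hGi.bdd_mul (P.measurable_ramp ε).aestronglyMeasurable (ae_of_all _ (hramp ε hε))
    have hint' : Integrable (fun p => A.e p * P.rampCovector ε ζ p (A.V p, 1) -
        A.c p * A.e p * (ζ p * P.ramp ε p) + A.F p * (ζ p * P.ramp ε p)) A.σ := (h1.sub h2).add h3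
    rw [← integral_sub hint hint', ← integral_const_mul, ← integral_neg,
      ← integral_indicator (P.isOpen_tube ε).measurableSet]
    refine integral_congr_ae (ae_of_all _ fun p => ?_)
    by_cases ht : p ∈ P.tube ε
    · simp only [indicator_of_mem ht, hG, Stratum.rampCovector, add_apply,
        smul_apply, smul_eq_mul]
      ring
    · simp only [indicator_of_notMem ht, hG, Stratum.rampCovector, add_apply,
        smul_apply, smul_eq_mul,
        zero_apply]
      ring
  -- The ramp tends to 1 on the domain off the stratum, which is `σ`-null; outside the domain `G`
  -- vanishes.
  have hlim1 : Tendsto (fun ε => ∫ p, P.ramp ε p * G p ∂A.σ) (𝓝[>] 0) (𝓝 (∫ p, G p ∂A.σ)) := by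
    refine tendsto_integral_filter_of_dominated_convergence (fun p => ‖G p‖) ?_ ?_ hGi.norm ?_
    · filter_upwards with ε
      exact (P.measurable_ramp ε).aestronglyMeasurable.mul hGi.aestronglyMeasurable
    · filter_upwards [self_mem_nhdsWithin] with ε hε
      refine ae_of_all _ fun p => ?_
      rw [norm_mul]
      exact mul_le_of_le_one_left (norm_nonneg _) (hramp ε hε p)
    · have : ∀ᵐ p ∂A.σ, p ∉ P.carrier := measure_eq_zero_iff_ae_notMem.1 hnull
      filter_upwards [this] with p hp
      by_cases hd : p ∈ P.dom
      · have h := (P.tendsto_ramp p).mul_const (G p)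
        rwa [indicator_of_mem (show p ∈ P.dom \ P.carrier from ⟨hd, hp⟩), Pi.one_apply,
          one_mul] at h
      · have h : p ∉ tsupport ζ := fun h => hd (hsupp h)
        have hf : fderiv ℝ ζ p = 0 := image_eq_zero_of_notMem_tsupport fun h' =>
          h (tsupport_fderiv_subset ℝ h')
        have : G p = 0 := by simp [hG, hf, image_eq_zero_of_notMem_tsupport h]
        simp [this]
  have hlim2 := A.tendsto_boundary (l := 𝓝[>] (0 : ℝ)) ho hi (h := fun ε => P.ramp ε)
    (g := fun p => (P.dom \ P.carrier).indicator 1 p)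
    (Eventually.of_forall fun ε => P.measurable_ramp ε)
    (by filter_upwards [self_mem_nhdsWithin] with ε hε using hramp ε hε)
    (fun p => (P.tendsto_ramp p).const_mul (ζ p))
  -- On the support of `ζ` the indicators of the stratum and of its complement in the domain add up
  -- to 1.
  have hfin : A.boundary (fun p => ζ p * P.carrier.indicator 1 p) =
      ∫ p, G p ∂A.σ - A.boundary fun p => ζ p * (P.dom \ P.carrier).indicator 1 p := by
    have hm1 : Measurable (P.carrier.indicator (1 : SpaceTime n → ℝ)) :=
      measurable_one.indicator P.measurableSet_carrier
    have hm2 : Measurable ((P.dom \ P.carrier).indicator (1 : SpaceTime n → ℝ)) :=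
      measurable_one.indicator (P.isOpen_dom.measurableSet.diff P.measurableSet_carrier)
    have hb1 : ∀ (B : Set (SpaceTime n)) p, |B.indicator (1 : SpaceTime n → ℝ) p| ≤ 1 := by
      intro B p
      by_cases hp : p ∈ B <;> simp [hp]
    rw [hbal, eq_sub_iff_add_eq, ← A.boundary_add
      (A.integrable_outflow_mul ho hm1 (hb1 _)) (A.integrable_inflow_mul hi hm1 (hb1 _))
      (A.integrable_outflow_mul ho hm2 (hb1 _)) (A.integrable_inflow_mul hi hm2 (hb1 _))]
    congr 1
    funext p
    by_cases hd : p ∈ P.dom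
    · by_cases hp : p ∈ P.carrier <;> simp [hd, hp]
    · have h : p ∉ tsupport ζ := fun h => hd (hsupp h)
      simp [image_eq_zero_of_notMem_tsupport h]
  rw [hfin]
  refine (hlim1.sub hlim2).congr' ?_
  filter_upwards [self_mem_nhdsWithin] with ε hε using (hstep ε hε).symm

end Sweep

/-! ### The mass of a stratum as a sweep. -/

namespace Stratum.Fibration

variable {n : ℕ} {T : ℝ} {P : Stratum n T} {v : SpaceTime n → Space n} {Y : Type*}
  [MeasurableSpace Y] (Φ : P.Fibration v Y) {ν : Measure Y} {σ : Measure (SpaceTime n)}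
  {μ : SpaceTime n → ℝ}

theorem measurableSet_domain :
    MeasurableSet {z : Y × ℝ | z.2 ∈ Ioo (Φ.start z.1) (Φ.finish z.1)} :=
  (measurableSet_lt (Φ.measurable_start.comp measurable_fst) measurable_snd).inter
    (measurableSet_lt measurable_snd (Φ.measurable_finish.comp measurable_fst))

variable {Φ}

theorem IsDensity.integrable_comp (hμ : Φ.IsDensity ν σ μ) {G : SpaceTime n → ℝ}
    (hG : Integrable G σ) :
    IntegrableOn (fun z : Y × ℝ => μ (Φ.path z.1 z.2, z.2) * G (Φ.path z.1 z.2, z.2))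
      {z | z.2 ∈ Ioo (Φ.start z.1) (Φ.finish z.1)} (ν.prod volume) ∧
    ∫ p, G p ∂σ = ∫ z in {z : Y × ℝ | z.2 ∈ Ioo (Φ.start z.1) (Φ.finish z.1)},
      μ (Φ.path z.1 z.2, z.2) * G (Φ.path z.1 z.2, z.2) ∂(ν.prod volume) := by
  have hQ : Measurable fun z : Y × ℝ => (Φ.path z.1 z.2, z.2) :=
    Φ.measurable_path.prodMk measurable_snd
  have hd : Measurable fun p => ENNReal.ofReal (μ p) := hμ.measurable.ennreal_ofReal
  have htop : ∀ᵐ p ∂(Φ.invariantMeasure ν), ENNReal.ofReal (μ p) < ⊤ :=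
    ae_of_all _ fun p => ENNReal.ofReal_lt_top
  have hcongr : ∀ z ∈ {z : Y × ℝ | z.2 ∈ Ioo (Φ.start z.1) (Φ.finish z.1)},
      (ENNReal.ofReal (μ (Φ.path z.1 z.2, z.2))).toReal • G (Φ.path z.1 z.2, z.2) =
        μ (Φ.path z.1 z.2, z.2) * G (Φ.path z.1 z.2, z.2) := fun z hz => by
    rw [ENNReal.toReal_ofReal (hμ.pos _ (Φ.mem z.1 z.2 hz)).le, smul_eq_mul]
  have h1 : Integrable (fun p => (ENNReal.ofReal (μ p)).toReal • G p) (Φ.invariantMeasure ν) := by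
    rw [hμ.eq] at hG
    exact (integrable_withDensity_iff_integrable_smul' hd htop).1 hG
  constructor
  · refine IntegrableOn.congr_fun ?_ hcongr Φ.measurableSet_domain
    exact (integrable_map_measure h1.aestronglyMeasurable hQ.aemeasurable).1 h1
  · rw [← setIntegral_congr_fun Φ.measurableSet_domain hcongr, hμ.eq,
      integral_withDensity_eq_integral_toReal_smul hd htop]
    exact integral_map hQ.aemeasurable h1.aestronglyMeasurable

/-- The mass `e δ(Γ)` of a stratum, carried by the trajectories of its velocity field. -/
def sweep [hν : SigmaFinite ν] (hμ : Φ.IsDensity ν σ μ) {f : Space n → ℝ} {e F : SpaceTime n → ℝ}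
    {w₀ : Y → ℝ} {w : Y → ℝ → ℝ} (he : IsAmplitude f σ v e) (hF : LocInt F σ)
    (hw : SolvesTransport Φ ν f μ e F w₀ w) : Sweep n Y where
  ν := ν
  sigmaFinite := hν
  σ := σ
  V := v
  c := fun p => f (v p)
  e := e
  F := F
  start := Φ.start
  finish := Φ.finish
  path := Φ.path
  amp := w
  weight := fun z => μ (Φ.path z.1 z.2, z.2)
  measurableSet := Φ.measurableSet_domain
  start_le := ae_of_all _ fun y => (Φ.start_lt_finish y).le
  integrable_comp := fun _ hG => (hμ.integrable_comp hG).1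
  integral_comp := fun _ hG => (hμ.integrable_comp hG).2
  amp_eq := by
    filter_upwards [hw] with y hy t ht
    rw [hy.2.2.1 t ht, mul_comm]
  continuousOn_path := ae_of_all _ Φ.continuousOn
  continuousOn_amp := by
    filter_upwards [hw] with y hy using hy.2.1
  hasDerivAt_path := ae_of_all _ Φ.ode
  hasDerivAt_amp := by
    filter_upwards [hw] with y hy t ht
    have h := hy.1 t ht
    have hev : w y =ᶠ[𝓝 t] fun s => e (Φ.path y s, s) * μ (Φ.path y s, s) := by
      filter_upwards [Ioo_mem_nhds ht.1 ht.2] with s hs using hy.2.2.1 s hs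
    refine (h.congr_of_eventuallyEq hev).congr_deriv ?_
    rw [hy.2.2.1 t ht]
    ring
  locInt_density := he.density
  locInt_flux := he.flux
  locInt_damping := he.source
  locInt_source := hF
  aemeasurable_start := ((Φ.measurable_path.comp
    (measurable_id.prodMk Φ.measurable_start)).prodMk Φ.measurable_start).aemeasurable
  aemeasurable_finish := ((Φ.measurable_path.comp
    (measurable_id.prodMk Φ.measurable_finish)).prodMk Φ.measurable_finish).aemeasurable

end Stratum.Fibration

/-! ### Smoothness of the density given by the Cauchy formula. -/

namespace IsEnteringFlow

variable {n : ℕ} {T : ℝ} {u : SpaceTime n → Space n} {Γ K : Set (SpaceTime n)}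
  {D₀ : Set (Space n)} {τ : Space n → ℝ} {X : Space n → ℝ → Space n}

/-- This is lower semicontinuity of the life time, on the open set `D₀`. -/
theorem isOpen_hypograph (hX : IsEnteringFlow T u Γ K D₀ τ X) :
    IsOpen {q : SpaceTime n | q.1 ∈ D₀ ∧ q.2 < τ q.1} := by
  rw [isOpen_iff_mem_nhds]
  rintro ⟨x, t⟩ ⟨hx, ht⟩
  obtain ⟨c, hc, hc'⟩ := exists_between ht
  have h1 : ∀ᶠ x' in 𝓝 x, c < τ x' := by
    have := hX.lsc x hx c hc'
    rwa [hX.isOpen.nhdsWithin_eq hx] at this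
  have h2 : ∀ᶠ x' in 𝓝 x, x' ∈ D₀ := hX.isOpen.mem_nhds hx
  have h3 : ∀ᶠ t' in 𝓝 t, t' < c := eventually_lt_nhds hc
  rw [nhds_prod_eq]
  filter_upwards [(h1.and h2).prod_mk h3] with q hq using ⟨hq.1.2, hq.2.trans hq.1.1⟩

theorem isOpen_domain (hX : IsEnteringFlow T u Γ K D₀ τ X) :
    IsOpen {q : SpaceTime n | q.1 ∈ D₀ ∧ 0 < q.2 ∧ q.2 < τ q.1} := by
  have h := hX.isOpen_hypograph.inter 
    (isOpen_lt (continuous_const (y := (0 : ℝ))) (continuous_snd (X := Space n)))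
  refine (congrArg IsOpen ?_).mp h
  ext q
  constructor
  · rintro ⟨⟨h1, h2⟩, h3⟩
    exact ⟨h1, h3, h2⟩
  · rintro ⟨h1, h3, h2⟩
    exact ⟨⟨h1, h2⟩, h3⟩

theorem uniqueDiffOn (hX : IsEnteringFlow T u Γ K D₀ τ X) :
    UniqueDiffOn ℝ {q : SpaceTime n | q.1 ∈ D₀ ∧ 0 ≤ q.2 ∧ q.2 < τ q.1} := by
  have h : UniqueDiffOn ℝ ((univ : Set (Space n)) ×ˢ Ici (0 : ℝ)) :=
    uniqueDiffOn_univ.prod (uniqueDiffOn_Ici 0)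
  refine (congrArg (UniqueDiffOn ℝ) ?_).mp (h.inter hX.isOpen_hypograph)
  ext q
  constructor
  · rintro ⟨⟨_, h3⟩, h1, h2⟩
    exact ⟨h1, h3, h2⟩
  · rintro ⟨h1, h3, h2⟩
    exact ⟨⟨trivial, h3⟩, h1, h2⟩

theorem contDiffAt (hX : IsEnteringFlow T u Γ K D₀ τ X) {q : SpaceTime n}
    (hq : q ∈ {q : SpaceTime n | q.1 ∈ D₀ ∧ 0 < q.2 ∧ q.2 < τ q.1}) :
    ContDiffAt ℝ ∞ (fun q : SpaceTime n => X q.1 q.2) q :=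
  (hX.smooth.mono fun _ h => ⟨h.1, h.2.1.le, h.2.2⟩).contDiffAt (hX.isOpen_domain.mem_nhds hq)

theorem continuousOn_path (hX : IsEnteringFlow T u Γ K D₀ τ X) {x : Space n} (hx : x ∈ D₀) :
    ContinuousOn (X x) (Ico 0 (τ x)) :=
  hX.smooth.continuousOn.comp (f := fun t : ℝ => ((x, t) : SpaceTime n)) (by fun_prop)
    fun _ ht => ⟨hx, ht.1, ht.2⟩

/-- The rate `f(u)` along the trajectories extends smoothly to the initial time. -/
theorem exists_contDiffOn_rate (hX : IsEnteringFlow T u Γ K D₀ τ X) {f : Space n → ℝ}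
    (hf : ContDiff ℝ ∞ f) :
    ∃ g : SpaceTime n → ℝ,
      ContDiffOn ℝ ∞ g {q : SpaceTime n | q.1 ∈ D₀ ∧ 0 ≤ q.2 ∧ q.2 < τ q.1} ∧
      ∀ x ∈ D₀, ∀ t ∈ Ioo 0 (τ x), f (u (X x t, t)) = g (x, t) := by
  -- `u` is only controlled for `t > 0`, where it equals `∂X/∂t`. The latter, taken within the
  -- domain, is smooth up to `t = 0` and supplies the extension.
  refine ⟨fun q => f (fderivWithin ℝ (fun q : SpaceTime n => X q.1 q.2)
    {q : SpaceTime n | q.1 ∈ D₀ ∧ 0 ≤ q.2 ∧ q.2 < τ q.1} q (0, 1)), ?_, ?_⟩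
  · exact hf.comp_contDiffOn
      ((hX.smooth.fderivWithin hX.uniqueDiffOn (by simp)).clm_apply contDiffOn_const)
  · intro x hx t ht
    have hmem : ((x, t) : SpaceTime n) ∈ {q : SpaceTime n | q.1 ∈ D₀ ∧ 0 < q.2 ∧ q.2 < τ q.1} :=
      ⟨hx, ht.1, ht.2⟩
    have hn : {q : SpaceTime n | q.1 ∈ D₀ ∧ 0 ≤ q.2 ∧ q.2 < τ q.1} ∈ 𝓝 ((x, t) : SpaceTime n) :=
      mem_of_superset (hX.isOpen_domain.mem_nhds hmem) fun _ h => ⟨h.1, h.2.1.le, h.2.2⟩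
    have h1 := ((hX.contDiffAt hmem).differentiableAt (by simp)).hasFDerivAt
    have h2 : HasDerivAt (fun s : ℝ => ((x, s) : SpaceTime n)) (0, 1) t :=
      (hasDerivAt_const t x).prodMk (hasDerivAt_id t)
    have h3 := h1.comp_hasDerivAt t h2
    rw [(hX.ode x hx t ht).unique h3]
    simp only
    rw [fderivWithin_of_mem_nhds hn]

/-- The substitution `s = t r` moves the variable limit into the integrand, which reduces the claim
to an integral over the fixed interval `[0, 1]`. -/
theorem contDiffOn_integral_rate (hX : IsEnteringFlow T u Γ K D₀ τ X) {f : Space n → ℝ}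
    (hf : ContDiff ℝ ∞ f) :
    ContDiffOn ℝ ∞ (fun q : SpaceTime n => ∫ s in (0 : ℝ)..q.2, f (u (X q.1 s, s)))
      {q : SpaceTime n | q.1 ∈ D₀ ∧ 0 < q.2 ∧ q.2 < τ q.1} := by
  obtain ⟨g, hg, hgu⟩ := hX.exists_contDiffOn_rate hf
  have hmaps : ∀ z ∈ {q : SpaceTime n | q.1 ∈ D₀ ∧ 0 < q.2 ∧ q.2 < τ q.1} ×ˢ Icc (0 : ℝ) 1,
      ((z.1.1, z.1.2 * z.2) : SpaceTime n) ∈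
        {q : SpaceTime n | q.1 ∈ D₀ ∧ 0 ≤ q.2 ∧ q.2 < τ q.1} := by
    rintro ⟨⟨x, t⟩, r⟩ ⟨⟨hx, ht, ht'⟩, hr, hr'⟩
    exact ⟨hx, mul_nonneg ht.le hr, (mul_le_of_le_one_right ht.le hr').trans_lt ht'⟩
  have h1 : ContDiffOn ℝ ∞ (fun z : SpaceTime n × ℝ => z.1.2 * g (z.1.1, z.1.2 * z.2))
      ({q : SpaceTime n | q.1 ∈ D₀ ∧ 0 < q.2 ∧ q.2 < τ q.1} ×ˢ Icc (0 : ℝ) 1) := by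
    refine ContDiffOn.mul (by fun_prop) (hg.comp (f := fun z : SpaceTime n × ℝ =>
      ((z.1.1, z.1.2 * z.2) : SpaceTime n)) (by fun_prop) hmaps)
  refine (h1.integral_zero_one hX.isOpen_domain).congr ?_
  rintro ⟨x, t⟩ ⟨hx, ht, ht'⟩
  simp only
  rw [intervalIntegral.integral_const_mul, ← smul_eq_mul,
    intervalIntegral.smul_integral_comp_mul_left (fun s => g (x, s)) t, mul_zero, mul_one,
    intervalIntegral.integral_of_le ht.le, intervalIntegral.integral_of_le ht.le]
  exact setIntegral_congr_fun measurableSet_Ioc fun s hs =>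
    hgu x hx s ⟨hs.1, hs.2.trans_lt ht'⟩

theorem fderiv_slice (hX : IsEnteringFlow T u Γ K D₀ τ X) {q : SpaceTime n}
    (hq : q ∈ {q : SpaceTime n | q.1 ∈ D₀ ∧ 0 < q.2 ∧ q.2 < τ q.1}) :
    fderiv ℝ (fun z => X z q.2) q.1 =
      (fderiv ℝ (fun q : SpaceTime n => X q.1 q.2) q).comp
        (ContinuousLinearMap.inl ℝ (Space n) ℝ) := by
  have h1 := ((hX.contDiffAt hq).differentiableAt (by simp)).hasFDerivAt
  have h2 : HasFDerivAt (fun z : Space n => ((z, q.2) : SpaceTime n))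
      (ContinuousLinearMap.inl ℝ (Space n) ℝ) q.1 := hasFDerivAt_prodMk_left q.1 q.2
  exact (HasFDerivAt.comp (g := fun q : SpaceTime n => X q.1 q.2) q.1 h1 h2).fderiv

theorem contDiffOn_det (hX : IsEnteringFlow T u Γ K D₀ τ X) :
    ContDiffOn ℝ ∞ (fun q : SpaceTime n => (fderiv ℝ (fun z => X z q.2) q.1).det)
      {q : SpaceTime n | q.1 ∈ D₀ ∧ 0 < q.2 ∧ q.2 < τ q.1} := by
  have h : ContDiffOn ℝ ∞ (fun q : SpaceTime n => X q.1 q.2)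
      {q : SpaceTime n | q.1 ∈ D₀ ∧ 0 < q.2 ∧ q.2 < τ q.1} :=
    fun q hq => (hX.contDiffAt hq).contDiffWithinAt
  have h1 := ((h.fderiv_of_isOpen hX.isOpen_domain (m := ∞) (by simp)).clm_comp
    (contDiffOn_const (c := ContinuousLinearMap.inl ℝ (Space n) ℝ))).clm_det
  exact h1.congr fun q hq => by rw [hX.fderiv_slice hq]

theorem contDiffOn_alongTrajectory (hX : IsEnteringFlow T u Γ K D₀ τ X) {f : Space n → ℝ}
    (hf : ContDiff ℝ ∞ f) {ρ₀ : Space n → ℝ} (hρ₀ : ContDiffOn ℝ ∞ ρ₀ D₀) :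
    ContDiffOn ℝ ∞ (fun q : SpaceTime n => alongTrajectory u f X ρ₀ q.1 q.2)
      {q : SpaceTime n | q.1 ∈ D₀ ∧ 0 < q.2 ∧ q.2 < τ q.1} := by
  have hne : ∀ q ∈ {q : SpaceTime n | q.1 ∈ D₀ ∧ 0 < q.2 ∧ q.2 < τ q.1},
      (fderiv ℝ (fun z => X z q.2) q.1).det ≠ 0 := fun q hq =>
    hX.nonsingular q.1 hq.1 q.2 ⟨hq.2.1, hq.2.2⟩
  refine ContDiffOn.mul (ContDiffOn.mul ?_ ?_) ?_
  · exact hρ₀.comp contDiffOn_fst fun q hq => hq.1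
  · refine ContDiffOn.inv ?_ fun q hq => abs_ne_zero.2 (hne q hq)
    intro q hq
    exact (contDiffAt_abs (hne q hq)).comp_contDiffWithinAt q (hX.contDiffOn_det q hq)
  · exact (hX.contDiffOn_integral_rate hf).neg.exp

theorem injOn (hX : IsEnteringFlow T u Γ K D₀ τ X) :
    InjOn (fun q : SpaceTime n => ((X q.1 q.2, q.2) : SpaceTime n))
      {q : SpaceTime n | q.1 ∈ D₀ ∧ 0 < q.2 ∧ q.2 < τ q.1} := by
  rintro ⟨x, t⟩ ⟨hx, ht, ht'⟩ ⟨x₁, t₁⟩ ⟨hx₁, ht₁, ht₁'⟩ h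
  simp only [Prod.mk.injEq] at h
  obtain ⟨h1, rfl⟩ := h
  rw [hX.inj x hx x₁ hx₁ t ⟨ht, ht'⟩ ⟨ht₁, ht₁'⟩ h1]

theorem hasFDerivAt (hX : IsEnteringFlow T u Γ K D₀ τ X) {q : SpaceTime n}
    (hq : q ∈ {q : SpaceTime n | q.1 ∈ D₀ ∧ 0 < q.2 ∧ q.2 < τ q.1}) :
    HasFDerivAt (fun q : SpaceTime n => ((X q.1 q.2, q.2) : SpaceTime n))
      ((fderiv ℝ (fun q : SpaceTime n => X q.1 q.2) q).prod
        (ContinuousLinearMap.snd ℝ (Space n) ℝ)) q :=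
  ((hX.contDiffAt hq).differentiableAt (by simp)).hasFDerivAt.prodMk hasFDerivAt_snd

theorem det_fderiv (hX : IsEnteringFlow T u Γ K D₀ τ X) {q : SpaceTime n}
    (hq : q ∈ {q : SpaceTime n | q.1 ∈ D₀ ∧ 0 < q.2 ∧ q.2 < τ q.1}) :
    ((fderiv ℝ (fun q : SpaceTime n => X q.1 q.2) q).prod
      (ContinuousLinearMap.snd ℝ (Space n) ℝ)).det = (fderiv ℝ (fun z => X z q.2) q.1).det :=
  ContinuousLinearMap.det_of_snd_eq _ _ (fun h => by rw [hX.fderiv_slice hq]; rfl) fun _ => rfl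

theorem cauchyDensity_apply (hX : IsEnteringFlow T u Γ K D₀ τ X) (f : Space n → ℝ)
    (ρ₀ : Space n → ℝ) {x : Space n} (hx : x ∈ D₀) {t : ℝ} (ht : t ∈ Ico 0 (τ x)) :
    cauchyDensity u f D₀ τ X ρ₀ (X x t, t) = alongTrajectory u f X ρ₀ x t := by
  have hex : ∃ x₀ ∈ {x₀ | x₀ ∈ D₀ ∧ t < τ x₀}, X x₀ t = X x t := ⟨x, ⟨hx, ht.2⟩, rfl⟩
  have h1 := Function.invFunOn_mem hex
  have h2 := Function.invFunOn_eq hex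
  have h3 : Function.invFunOn (fun x₀ => X x₀ t) {x₀ | x₀ ∈ D₀ ∧ t < τ x₀} (X x t) = x := by
    -- The hypothesis `inj` concerns positive times; at `t = 0` the map is the identity on `D₀`.
    rcases ht.1.eq_or_lt with h0 | h0
    · subst h0
      rw [hX.init _ h1.1, hX.init x hx] at h2
      rw [hX.init x hx]
      exact h2
    · exact hX.inj _ h1.1 x hx t ⟨h0, h1.2⟩ ⟨h0, ht.2⟩ h2
  rw [cauchyDensity, h3]

theorem alongTrajectory_zero (hX : IsEnteringFlow T u Γ K D₀ τ X) (f : Space n → ℝ)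
    (ρ₀ : Space n → ℝ) {x : Space n} (hx : x ∈ D₀) : alongTrajectory u f X ρ₀ x 0 = ρ₀ x := by
  have h : (fun z => X z 0) =ᶠ[𝓝 x] id := by
    filter_upwards [hX.isOpen.mem_nhds hx] with z hz using hX.init z hz
  have h1 : (fderiv ℝ (fun z => X z 0) x).det = 1 := by
    rw [h.fderiv_eq, fderiv_id, ContinuousLinearMap.det]
    exact LinearMap.det_id
  simp [alongTrajectory, h1]

/-- The density given by the Cauchy formula is smooth off the singular set. -/
theorem contDiffOn_cauchyDensity (hX : IsEnteringFlow T u Γ K D₀ τ X) {f : Space n → ℝ}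
    (hf : ContDiff ℝ ∞ f) {ρ₀ : Space n → ℝ} (hρ₀ : ContDiffOn ℝ ∞ ρ₀ D₀) :
    ContDiffOn ℝ ∞ (cauchyDensity u f D₀ τ X ρ₀) (strip n T \ (Γ ∪ K)) := by
  rintro ⟨x', t⟩ hp
  obtain ⟨x, hx, ht, hxp⟩ := hX.cover _ hp.1 hp.2
  simp only at ht hxp
  subst hxp
  set Ω := {q : SpaceTime n | q.1 ∈ D₀ ∧ 0 < q.2 ∧ q.2 < τ q.1} with hΩ
  have hq : ((x, t) : SpaceTime n) ∈ Ω := ⟨hx, hp.1.1, ht⟩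
  have hdet : ((fderiv ℝ (fun q : SpaceTime n => X q.1 q.2) (x, t)).prod
      (ContinuousLinearMap.snd ℝ (Space n) ℝ)).det ≠ 0 := by
    rw [hX.det_fderiv hq]
    exact hX.nonsingular x hx t ⟨hp.1.1, ht⟩
  have hΨ : ContDiffAt ℝ ∞ (fun q : SpaceTime n => ((X q.1 q.2, q.2) : SpaceTime n)) (x, t) :=
    (hX.contDiffAt hq).prodMk contDiffAt_snd
  have hΨ' : HasFDerivAt (fun q : SpaceTime n => ((X q.1 q.2, q.2) : SpaceTime n))
      ((ContinuousLinearMap.toContinuousLinearEquivOfDetNeZero _ hdet :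
        SpaceTime n ≃L[ℝ] SpaceTime n) : SpaceTime n →L[ℝ] SpaceTime n) (x, t) := by
    rw [ContinuousLinearMap.coe_toContinuousLinearEquivOfDetNeZero]
    exact hX.hasFDerivAt hq
  -- Near the point, the density is `alongTrajectory` composed with the smooth local inverse of
  -- `(x₀, t) ↦ (X x₀ t, t)`, by global injectivity of this map.
  set g := hΨ.localInverse hΨ' (by simp) with hg
  have hgs : ContDiffAt ℝ ∞ g (X x t, t) := hΨ.to_localInverse hΨ' (by simp)
  have hg0 : g (X x t, t) = (x, t) := hΨ.localInverse_apply_image hΨ' (by simp)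
  have hgr : ∀ᶠ p in 𝓝 ((X x t, t) : SpaceTime n), (X (g p).1 (g p).2, (g p).2) = p :=
    (hΨ.hasStrictFDerivAt' hΨ' (by simp)).eventually_right_inverse
  have hgΩ : ∀ᶠ p in 𝓝 ((X x t, t) : SpaceTime n), g p ∈ Ω := by
    refine hgs.continuousAt.preimage_mem_nhds ?_
    rw [hg0]
    exact hX.isOpen_domain.mem_nhds hq
  have hsm : ContDiffAt ℝ ∞ (fun p => alongTrajectory u f X ρ₀ (g p).1 (g p).2)
      ((X x t, t) : SpaceTime n) := by
    have h1 : ContDiffAt ℝ ∞ (fun q : SpaceTime n => alongTrajectory u f X ρ₀ q.1 q.2)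
        (g (X x t, t)) := by
      rw [hg0]
      exact (hX.contDiffOn_alongTrajectory hf hρ₀).contDiffAt (hX.isOpen_domain.mem_nhds hq)
    exact h1.comp _ hgs
  refine (hsm.congr_of_eventuallyEq ?_).contDiffWithinAt
  filter_upwards [hgr, hgΩ] with p hp1 hp2
  rw [← hX.cauchyDensity_apply f ρ₀ hp2.1 ⟨hp2.2.1.le, hp2.2.2⟩, hp1]

end IsEnteringFlow

/-! ### The regular part, stopped at a time `T' < T`, as a sweep. -/

namespace IsEnteringFlow

variable {n : ℕ} {T : ℝ} {u : SpaceTime n → Space n} {Γ K : Set (SpaceTime n)}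
  {D₀ : Set (Space n)} {τ : Space n → ℝ} {X : Space n → ℝ → Space n}

open scoped Classical in
/-- The life time of the trajectories, cut off at time `T'`. -/
def cutTime (D₀ : Set (Space n)) (τ : Space n → ℝ) (T' : ℝ) (x : Space n) : ℝ :=
  if x ∈ D₀ then min (τ x) T' else 0

/-- The trajectories, extended to their end points. -/
def endedPath (D₀ : Set (Space n)) (τ : Space n → ℝ) (X : Space n → ℝ → Space n) (T' : ℝ)
    (x : Space n) : ℝ → Space n :=
  extendFrom (Ioo 0 (cutTime D₀ τ T' x)) (X x)

/-- The amplitude carried along the trajectories, `ρ₀ exp (-∫ f(u))`. -/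
def rawAmp (u : SpaceTime n → Space n) (f : Space n → ℝ) (X : Space n → ℝ → Space n)
    (ρ₀ : Space n → ℝ) (x : Space n) (t : ℝ) : ℝ :=
  ρ₀ x * Real.exp (-∫ s in (0 : ℝ)..t, f (u (X x s, s)))

/-- The amplitude as the integral of its derivative, which makes sense up to the end points. -/
def endedAmp (u : SpaceTime n → Space n) (f : Space n → ℝ) (X : Space n → ℝ → Space n)
    (ρ₀ : Space n → ℝ) (x : Space n) (t : ℝ) : ℝ :=
  ρ₀ x + ∫ s in (0 : ℝ)..t, -(f (u (X x s, s)) * rawAmp u f X ρ₀ x s)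

/-- The value 0 of `cutTime` off `D₀` leaves an empty time interval there, so membership in `D₀`
need not be stated separately. -/
theorem domain_cutTime_eq (D₀ : Set (Space n)) (τ : Space n → ℝ) (T' : ℝ) :
    {z : Space n × ℝ | z.2 ∈ Ioo 0 (cutTime D₀ τ T' z.1)} =
      {q : SpaceTime n | q.1 ∈ D₀ ∧ 0 < q.2 ∧ q.2 < τ q.1} ∩ {q | q.2 < T'} := by
  ext ⟨x, t⟩
  simp only [cutTime, mem_inter_iff, mem_ofPred_eq, mem_Ioo]
  by_cases hx : x ∈ D₀
  · simp [hx, and_assoc]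
  · simp only [hx, if_false, false_and, iff_false]
    exact fun h => (h.1.trans h.2).false

theorem isOpen_domain_cutTime (hX : IsEnteringFlow T u Γ K D₀ τ X) (T' : ℝ) :
    IsOpen {z : Space n × ℝ | z.2 ∈ Ioo 0 (cutTime D₀ τ T' z.1)} := by
  rw [domain_cutTime_eq]
  exact hX.isOpen_domain.inter (isOpen_lt continuous_snd continuous_const)

theorem cutTime_pos (hX : IsEnteringFlow T u Γ K D₀ τ X) {T' : ℝ} (hT' : 0 < T') {x : Space n}
    (hx : x ∈ D₀) : 0 < cutTime D₀ τ T' x := by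
  rw [cutTime, if_pos hx]
  exact lt_min (hX.pos x hx) hT'

theorem cutTime_le {T' : ℝ} {x : Space n} (hx : x ∈ D₀) : cutTime D₀ τ T' x ≤ τ x := by
  rw [cutTime, if_pos hx]
  exact min_le_left _ _

theorem Ioo_cutTime_subset {T' : ℝ} {x : Space n} (hx : x ∈ D₀) :
    Ioo 0 (cutTime D₀ τ T' x) ⊆ Ioo 0 (τ x) := Ioo_subset_Ioo_right (cutTime_le hx)

theorem measurable_cutTime (hX : IsEnteringFlow T u Γ K D₀ τ X) {T' : ℝ} (hT' : 0 < T') :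
    Measurable (cutTime D₀ τ T') := by
  refine measurable_of_Ioi fun c => ?_
  rcases lt_or_ge c 0 with hc | hc
  · have : cutTime D₀ τ T' ⁻¹' Ioi c = univ := by
      refine eq_univ_of_forall fun x => ?_
      by_cases hx : x ∈ D₀
      · exact hc.trans (hX.cutTime_pos hT' hx)
      · simpa [cutTime, hx] using hc
    rw [this]
    exact MeasurableSet.univ
  · by_cases hcT : c < T'
    · have : cutTime D₀ τ T' ⁻¹' Ioi c =
          (fun x => ((x, c) : SpaceTime n)) ⁻¹' {q : SpaceTime n | q.1 ∈ D₀ ∧ q.2 < τ q.1} := by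
        ext x
        by_cases hx : x ∈ D₀
        · simp [cutTime, hx, hcT]
        · simp [cutTime, hx, hc]
      rw [this]
      exact (hX.isOpen_hypograph.preimage (by fun_prop)).measurableSet
    · have : cutTime D₀ τ T' ⁻¹' Ioi c = ∅ := by
        refine eq_empty_of_forall_notMem fun x hx => ?_
        have hx : c < cutTime D₀ τ T' x := hx
        rw [cutTime] at hx
        split_ifs at hx
        · exact hcT (hx.trans_le (min_le_right _ _))
        · exact (hx.trans_le hc).false
      rw [this]
      exact MeasurableSet.empty

theorem mem_ae (hX : IsEnteringFlow T u Γ K D₀ τ X) : ∀ᵐ x : Space n, x ∈ D₀ := hX.full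

theorem continuousAt_path (hX : IsEnteringFlow T u Γ K D₀ τ X) {x : Space n} (hx : x ∈ D₀)
    {t : ℝ} (ht : t ∈ Ioo 0 (τ x)) : ContinuousAt (X x) t :=
  ((hX.continuousOn_path hx).mono Ioo_subset_Ico_self).continuousAt (Ioo_mem_nhds ht.1 ht.2)

theorem endedPath_eq (hX : IsEnteringFlow T u Γ K D₀ τ X) {T' : ℝ} {x : Space n}
    (hx : x ∈ D₀) {t : ℝ} (ht : t ∈ Ioo 0 (cutTime D₀ τ T' x)) :
    endedPath D₀ τ X T' x t = X x t :=
  extendFrom_eq (subset_closure ht)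
    (hX.continuousAt_path hx (Ioo_cutTime_subset hx ht)).continuousWithinAt

theorem tendsto_path_zero (hX : IsEnteringFlow T u Γ K D₀ τ X) {x : Space n} (hx : x ∈ D₀) :
    Tendsto (X x) (𝓝[>] 0) (𝓝 x) := by
  have h := hX.continuousOn_path hx 0 ⟨le_rfl, hX.pos x hx⟩
  rw [ContinuousWithinAt, hX.init x hx] at h
  refine h.mono_left ?_
  rw [← nhdsWithin_Ioo_eq_nhdsGT (hX.pos x hx)]
  exact nhdsWithin_mono _ Ioo_subset_Ico_self

/-- A trajectory that stops by `T'` stops before `T`, hence enters the singular set and has a limit;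
any other one is continuous at `T'`. -/
theorem exists_tendsto_path_cutTime (hX : IsEnteringFlow T u Γ K D₀ τ X) {T' : ℝ}
    (hT' : 0 < T') (hT'T : T' < T) {x : Space n} (hx : x ∈ D₀) :
    ∃ z, Tendsto (X x) (𝓝[<] (cutTime D₀ τ T' x)) (𝓝 z) := by
  have hb : cutTime D₀ τ T' x = min (τ x) T' := if_pos hx
  rcases le_or_gt (τ x) T' with h | h
  · rw [hb, min_eq_left h]
    obtain ⟨z, -, hz⟩ := hX.enter x hx (h.trans_lt hT'T)
    exact ⟨z, hz⟩
  · rw [hb, min_eq_right h.le]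
    exact ⟨_, (hX.continuousAt_path hx ⟨hT', h⟩).continuousWithinAt⟩

theorem continuousOn_endedPath (hX : IsEnteringFlow T u Γ K D₀ τ X) {T' : ℝ}
    (hT' : 0 < T') (hT'T : T' < T) {x : Space n} (hx : x ∈ D₀) :
    ContinuousOn (endedPath D₀ τ X T' x) (Icc 0 (cutTime D₀ τ T' x)) := by
  obtain ⟨z, hz⟩ := hX.exists_tendsto_path_cutTime hT' hT'T hx
  exact continuousOn_Icc_extendFrom_Ioo
    ((hX.continuousOn_path hx).mono ((Ioo_cutTime_subset hx).trans Ioo_subset_Ico_self))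
    (hX.tendsto_path_zero hx) hz

theorem endedPath_zero (hX : IsEnteringFlow T u Γ K D₀ τ X) {T' : ℝ} (hT' : 0 < T')
    {x : Space n} (hx : x ∈ D₀) : endedPath D₀ τ X T' x 0 = x :=
  eq_lim_at_left_extendFrom_Ioo (hX.cutTime_pos hT' hx) (hX.tendsto_path_zero hx)

/-- Almost every trajectory which ends before the cut-off time ends on `Γ`. -/
theorem endedPath_cutTime_mem (hX : IsEnteringFlow T u Γ K D₀ τ X) {T' : ℝ} (hT' : 0 < T')
    (hT'T : T' < T) : ∀ᵐ x : Space n,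
      (endedPath D₀ τ X T' x (cutTime D₀ τ T' x), cutTime D₀ τ T' x) ∈ Γ ∨
        cutTime D₀ τ T' x = T' := by
  filter_upwards [hX.mem_ae, hX.enter_ae] with x hx hx'
  have hb : cutTime D₀ τ T' x = min (τ x) T' := if_pos hx
  rcases le_or_gt (τ x) T' with h | h
  · left
    obtain ⟨z, hz, hz'⟩ := hx' hx (h.trans_lt hT'T)
    have hb' : cutTime D₀ τ T' x = τ x := by rw [hb, min_eq_left h]
    have : endedPath D₀ τ X T' x (cutTime D₀ τ T' x) = z :=
      eq_lim_at_right_extendFrom_Ioo (hX.cutTime_pos hT' hx) (by rwa [hb'])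
    rwa [this, hb']
  · right
    rw [hb, min_eq_right h.le]

/-- `rawAmp` solves the damping ODE, so for `t < τ x` it is its initial value plus the integral of
its derivative. At `t = τ x` the rate `f(u)` may fail to be integrable and `rawAmp` loses its
meaning; `endedAmp` needs integrability of the product only. -/
theorem hasDerivAt_rawAmp (hX : IsEnteringFlow T u Γ K D₀ τ X) {f : Space n → ℝ}
    (hf : ContDiff ℝ ∞ f) (ρ₀ : Space n → ℝ) {x : Space n} (hx : x ∈ D₀) :
    (∀ t ∈ Ioo 0 (τ x), HasDerivAt (rawAmp u f X ρ₀ x)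
      (-(f (u (X x t, t)) * rawAmp u f X ρ₀ x t)) t) ∧
    ∀ t ∈ Ico 0 (τ x), endedAmp u f X ρ₀ x t = rawAmp u f X ρ₀ x t := by
  obtain ⟨g, hg, hgu⟩ := hX.exists_contDiffOn_rate hf
  have hgc : ContinuousOn (fun t => g (x, t)) (Ico 0 (τ x)) :=
    hg.continuousOn.comp (f := fun t : ℝ => ((x, t) : SpaceTime n)) (by fun_prop)
      fun _ ht => ⟨hx, ht.1, ht.2⟩
  have hI : ∀ t ∈ Ico 0 (τ x), ∫ s in (0 : ℝ)..t, f (u (X x s, s)) =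
      ∫ s in (0 : ℝ)..t, g (x, s) := by
    intro t ht
    rw [intervalIntegral.integral_of_le ht.1, intervalIntegral.integral_of_le ht.1]
    exact setIntegral_congr_fun measurableSet_Ioc fun s hs =>
      hgu x hx s ⟨hs.1, hs.2.trans_lt ht.2⟩
  have hii : ∀ t ∈ Ico 0 (τ x), IntervalIntegrable (fun s => g (x, s)) volume 0 t := by
    intro t ht
    refine (hgc.mono ?_).intervalIntegrable
    rw [uIcc_of_le ht.1]
    exact fun s hs => ⟨hs.1, hs.2.trans_lt ht.2⟩
  set I : ℝ → ℝ := fun t => ∫ s in (0 : ℝ)..t, g (x, s) with hIdef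
  have hId : ∀ t ∈ Ioo 0 (τ x), HasDerivAt I (g (x, t)) t := by
    intro t ht
    have hn : Ioo 0 (τ x) ∈ 𝓝 t := Ioo_mem_nhds ht.1 ht.2
    have hgc' := hgc.mono Ioo_subset_Ico_self
    exact intervalIntegral.integral_hasDerivAt_right (hii t (Ioo_subset_Ico_self ht))
      (hgc'.stronglyMeasurableAtFilter isOpen_Ioo t ht) (hgc'.continuousAt hn)
  have hraw : ∀ t ∈ Ico 0 (τ x), rawAmp u f X ρ₀ x t = ρ₀ x * Real.exp (-I t) := fun t ht => by
    rw [rawAmp, hI t ht]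
  have hd : ∀ t ∈ Ioo 0 (τ x), HasDerivAt (fun t => ρ₀ x * Real.exp (-I t))
      (-(g (x, t) * (ρ₀ x * Real.exp (-I t)))) t := by
    intro t ht
    refine ((hId t ht).neg.exp.const_mul (ρ₀ x)).congr_deriv ?_
    simp only [Pi.neg_apply]
    ring
  constructor
  · intro t ht
    have hev : rawAmp u f X ρ₀ x =ᶠ[𝓝 t] fun t => ρ₀ x * Real.exp (-I t) := by
      filter_upwards [Ioo_mem_nhds ht.1 ht.2] with s hs using hraw s (Ioo_subset_Ico_self hs)
    refine ((hd t ht).congr_of_eventuallyEq hev).congr_deriv ?_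
    rw [hgu x hx t ht, hraw t (Ioo_subset_Ico_self ht)]
  · intro t ht
    have hsub : Icc 0 t ⊆ Ico 0 (τ x) := fun s hs => ⟨hs.1, hs.2.trans_lt ht.2⟩
    have hIc : ContinuousOn I (Icc 0 t) := by
      have := intervalIntegral.continuousOn_primitive_interval' (hii t ht) left_mem_uIcc
      rwa [uIcc_of_le ht.1] at this
    have hac : ContinuousOn (fun t => ρ₀ x * Real.exp (-I t)) (Icc 0 t) :=
      continuousOn_const.mul hIc.neg.rexp
    have hint : ∫ s in (0 : ℝ)..t, -(f (u (X x s, s)) * rawAmp u f X ρ₀ x s) =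
        ∫ s in (0 : ℝ)..t, -(g (x, s) * (ρ₀ x * Real.exp (-I s))) := by
      rw [intervalIntegral.integral_of_le ht.1, intervalIntegral.integral_of_le ht.1]
      refine setIntegral_congr_fun measurableSet_Ioc fun s hs => ?_
      rw [hgu x hx s ⟨hs.1, hs.2.trans_lt ht.2⟩, hraw s ⟨hs.1.le, hs.2.trans_lt ht.2⟩]
    rw [endedAmp, hint, intervalIntegral.integral_eq_sub_of_hasDerivAt_of_le ht.1 hac
      (fun s hs => hd s ⟨hs.1, hs.2.trans ht.2⟩), ← hraw t ht]
    · rw [show I 0 = 0 from intervalIntegral.integral_same]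
      simp
    · refine ContinuousOn.intervalIntegrable ?_
      rw [uIcc_of_le ht.1]
      exact ((hgc.mono hsub).mul hac).neg

/-- The change of variables from the strip to the initial positions. -/
theorem integrable_comp (hX : IsEnteringFlow T u Γ K D₀ τ X) {T' : ℝ} {G : SpaceTime n → ℝ}
    (hG : IntegrableOn G ((strip n T \ (Γ ∪ K)) ∩ {p | p.2 < T'}) volume) :
    IntegrableOn (fun z : Space n × ℝ => |(fderiv ℝ (fun y => X y z.2) z.1).det| *
        G (endedPath D₀ τ X T' z.1 z.2, z.2))
      {z | z.2 ∈ Ioo 0 (cutTime D₀ τ T' z.1)} ((volume : Measure (Space n)).prod volume) ∧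
    ∫ p in (strip n T \ (Γ ∪ K)) ∩ {p | p.2 < T'}, G p =
      ∫ z in {z : Space n × ℝ | z.2 ∈ Ioo 0 (cutTime D₀ τ T' z.1)},
        |(fderiv ℝ (fun y => X y z.2) z.1).det| * G (endedPath D₀ τ X T' z.1 z.2, z.2)
        ∂((volume : Measure (Space n)).prod volume) := by
  have := isAddHaarMeasure_volume_spaceTime n
  set Ω := {z : Space n × ℝ | z.2 ∈ Ioo 0 (cutTime D₀ τ T' z.1)} with hΩ
  have hΩm : MeasurableSet Ω := (hX.isOpen_domain_cutTime T').measurableSet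
  have hsub : ∀ q ∈ Ω, q ∈ {q : SpaceTime n | q.1 ∈ D₀ ∧ 0 < q.2 ∧ q.2 < τ q.1} := by
    intro q hq
    rw [hΩ, domain_cutTime_eq] at hq
    exact hq.1
  set Ψ : SpaceTime n → SpaceTime n := fun q => (X q.1 q.2, q.2) with hΨ
  set Ψ' : SpaceTime n → SpaceTime n →L[ℝ] SpaceTime n := fun q =>
    (fderiv ℝ (fun q : SpaceTime n => X q.1 q.2) q).prod (ContinuousLinearMap.snd ℝ (Space n) ℝ)
  -- Together with injectivity, the covering hypothesis makes the flow map a bijection onto the part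
  -- of the strip off the strata and before `T'`.
  have himg : Ψ '' Ω = (strip n T \ (Γ ∪ K)) ∩ {p | p.2 < T'} := by
    rw [hΩ, domain_cutTime_eq]
    ext ⟨x', t⟩
    constructor
    · rintro ⟨⟨x, s⟩, ⟨⟨hx, hs, hs'⟩, hsT⟩, h⟩
      simp only [hΨ, Prod.mk.injEq] at h
      obtain ⟨rfl, rfl⟩ := h
      exact ⟨⟨⟨hs, hs'.trans_le (hX.le x hx)⟩, hX.avoid x hx s ⟨hs, hs'⟩⟩, hsT⟩
    · rintro ⟨⟨hs, hn⟩, hT⟩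
      obtain ⟨x, hx, ht, hxt⟩ := hX.cover _ hs hn
      exact ⟨(x, t), ⟨⟨hx, hs.1, ht⟩, hT⟩, by simp only [hΨ]; exact congrArg (·, t) hxt⟩
  have hd : ∀ q ∈ Ω, HasFDerivWithinAt Ψ (Ψ' q) Ω q := fun q hq =>
    (hX.hasFDerivAt (hsub q hq)).hasFDerivWithinAt
  have hinj : InjOn Ψ Ω := hX.injOn.mono hsub
  have hcongr : ∀ z ∈ Ω, |(Ψ' z).det| • G (Ψ z) =
      |(fderiv ℝ (fun y => X y z.2) z.1).det| * G (endedPath D₀ τ X T' z.1 z.2, z.2) := by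
    intro z hz
    rw [hX.det_fderiv (hsub z hz), hX.endedPath_eq (hsub z hz).1 hz, smul_eq_mul]
  constructor
  · refine IntegrableOn.congr_fun ?_ hcongr hΩm
    rw [← himg] at hG
    exact (integrableOn_image_iff_integrableOn_abs_det_fderiv_smul volume hΩm hd hinj G).1 hG
  · rw [← setIntegral_congr_fun hΩm hcongr, ← himg]
    exact integral_image_eq_integral_abs_det_fderiv_smul volume hΩm hd hinj G

theorem abs_det_mul_cauchyDensity (hX : IsEnteringFlow T u Γ K D₀ τ X) (f : Space n → ℝ)
    (ρ₀ : Space n → ℝ) {x : Space n} (hx : x ∈ D₀) {t : ℝ} (ht : t ∈ Ioo 0 (τ x)) :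
    |(fderiv ℝ (fun y => X y t) x).det| * cauchyDensity u f D₀ τ X ρ₀ (X x t, t) =
      rawAmp u f X ρ₀ x t := by
  rw [hX.cauchyDensity_apply f ρ₀ hx (Ioo_subset_Ico_self ht), alongTrajectory, rawAmp]
  have := abs_ne_zero.2 (hX.nonsingular x hx t ht)
  field_simp

theorem locInt_restrict {G : Type*} [NormedAddCommGroup G] {g : SpaceTime n → G}
    (h : LocInt g (volume.restrict (strip n T))) (S : Set (SpaceTime n)) (hS : S ⊆ strip n T) :
    LocInt g (volume.restrict S) :=
  fun r => (h r).mono_measure (Measure.restrict_mono hS le_rfl)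

/-- By change of variables and Fubini, local integrability of `f(u) R` passes to almost every
trajectory, ball by ball. Countably many balls suffice, since a trajectory with its end points is
compact and lies in one of them. This yields continuity of `endedAmp` up to the end. -/
theorem intervalIntegrable_endedAmp (hX : IsEnteringFlow T u Γ K D₀ τ X) {f : Space n → ℝ}
    {ρ₀ : Space n → ℝ} (hint : IsRegularDensity T u f (cauchyDensity u f D₀ τ X ρ₀)) {T' : ℝ}
    (hT' : 0 < T') (hT'T : T' < T) :
    ∀ᵐ x : Space n, IntervalIntegrable (fun s => -(f (u (X x s, s)) * rawAmp u f X ρ₀ x s)) volume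
      0 (cutTime D₀ τ T' x) := by
  set Ω := {z : Space n × ℝ | z.2 ∈ Ioo 0 (cutTime D₀ τ T' z.1)} with hΩ
  have hΩm : MeasurableSet Ω := (hX.isOpen_domain_cutTime T').measurableSet
  set H : SpaceTime n → ℝ := fun p => f (u p) * cauchyDensity u f D₀ τ X ρ₀ p
  have hk : ∀ k : ℕ, ∀ᵐ x : Space n, Integrable (fun t => Ω.indicator (fun z : Space n × ℝ =>
      |(fderiv ℝ (fun y => X y z.2) z.1).det| * (Metric.closedBall (0 : SpaceTime n) k).indicator H
        (endedPath D₀ τ X T' z.1 z.2, z.2)) (x, t)) := by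
    intro k
    have h1 : IntegrableOn ((Metric.closedBall (0 : SpaceTime n) (k : ℝ)).indicator H)
        ((strip n T \ (Γ ∪ K)) ∩ {p | p.2 < T'}) volume := by
      have h2 := locInt_restrict hint.source ((strip n T \ (Γ ∪ K)) ∩ {p | p.2 < T'})
        (inter_subset_left.trans sdiff_subset) (k : ℝ)
      exact (integrable_indicator_iff Metric.isClosed_closedBall.measurableSet).2 h2
    exact ((hX.integrable_comp h1).1.integrable_indicator hΩm).prod_right_ae
  filter_upwards [hX.mem_ae, ae_all_iff.2 hk] with x hx hxk
  have hpos := hX.cutTime_pos hT' hx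
  have hcomp : IsCompact ((fun t => ((endedPath D₀ τ X T' x t, t) : SpaceTime n)) ''
      Icc 0 (cutTime D₀ τ T' x)) :=
    isCompact_Icc.image_of_continuousOn
      ((hX.continuousOn_endedPath hT' hT'T hx).prodMk continuousOn_id)
  obtain ⟨r, hr⟩ := hcomp.isBounded.subset_closedBall 0
  obtain ⟨k, hkr⟩ := exists_nat_ge r
  rw [intervalIntegrable_iff_integrableOn_Ioo_of_le hpos.le]
  refine ((integrable_indicator_iff measurableSet_Ioo).1 ((hxk k).congr (ae_of_all _ fun t => ?_))).neg
  by_cases ht : t ∈ Ioo 0 (cutTime D₀ τ T' x)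
  · have hmem : (endedPath D₀ τ X T' x t, t) ∈ Metric.closedBall (0 : SpaceTime n) (k : ℝ) :=
      Metric.closedBall_subset_closedBall hkr (hr ⟨t, Ioo_subset_Icc_self ht, rfl⟩)
    simp only
    rw [indicator_of_mem ht, indicator_of_mem (show (x, t) ∈ Ω from ht), indicator_of_mem hmem,
      hX.endedPath_eq hx ht, ← hX.abs_det_mul_cauchyDensity f ρ₀ hx (Ioo_cutTime_subset hx ht)]
    ring
  · simp only
    rw [indicator_of_notMem ht, indicator_of_notMem (show (x, t) ∉ Ω from ht)]

theorem aemeasurable_endedPath_cutTime (hX : IsEnteringFlow T u Γ K D₀ τ X) {T' : ℝ}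
    (hT' : 0 < T') (hT'T : T' < T) :
    AEMeasurable (fun x : Space n => (endedPath D₀ τ X T' x (cutTime D₀ τ T' x),
      cutTime D₀ τ T' x)) := by
  classical
  set Ω := {z : Space n × ℝ | z.2 ∈ Ioo 0 (cutTime D₀ τ T' z.1)} with hΩ
  have hΩm : MeasurableSet Ω := (hX.isOpen_domain_cutTime T').measurableSet
  have hb := hX.measurable_cutTime hT'
  refine AEMeasurable.prodMk ?_ hb.aemeasurable
  set Xm : Space n × ℝ → Space n := Ω.piecewise (fun z => X z.1 z.2) (fun _ => 0) with hXm
  have hXmm : Measurable Xm := by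
    refine ContinuousOn.measurable_piecewise ?_ continuousOn_const hΩm
    refine hX.smooth.continuousOn.mono fun q hq => ?_
    rw [hΩ, domain_cutTime_eq] at hq
    exact ⟨hq.1.1, hq.1.2.1.le, hq.1.2.2⟩
  have hlim1 : Tendsto (fun k : ℕ => 1 - 1 / ((k : ℝ) + 2)) atTop (𝓝 1) := by
    have h1 : Tendsto (fun k : ℕ => 1 / ((k : ℝ) + 2)) atTop (𝓝 0) := by
      have := tendsto_natCast_atTop_atTop (R := ℝ)
      simp only [one_div]
      exact (tendsto_atTop_add_const_right atTop 2 this).inv_tendsto_atTop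
    simpa using h1.const_sub 1
  -- The end point is the limit of positions at interior times: the factor `1 - 1/(k+2)` lies
  -- strictly between 0 and 1 for every `k`, including `k = 0`.
  refine aemeasurable_of_tendsto_metrizable_ae atTop
    (f := fun (k : ℕ) x => Xm (x, cutTime D₀ τ T' x * (1 - 1 / ((k : ℝ) + 2)))) ?_ ?_
  · intro k
    exact (hXmm.comp (measurable_id.prodMk (hb.mul_const _))).aemeasurable
  · filter_upwards [hX.mem_ae] with x hx
    have hpos := hX.cutTime_pos hT' hx
    have hmem : ∀ k : ℕ, cutTime D₀ τ T' x * (1 - 1 / ((k : ℝ) + 2)) ∈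
        Ioo 0 (cutTime D₀ τ T' x) := by
      intro k
      have hk : (0 : ℝ) < (k : ℝ) + 2 := by positivity
      have h1 : 0 < 1 / ((k : ℝ) + 2) := by positivity
      have h2 : 1 / ((k : ℝ) + 2) < 1 := by
        rw [div_lt_one hk]
        linarith [(Nat.cast_nonneg k : (0 : ℝ) ≤ k)]
      constructor <;> nlinarith
    have hc := hX.continuousOn_endedPath hT' hT'T hx (cutTime D₀ τ T' x) ⟨hpos.le, le_rfl⟩
    have hseq : Tendsto (fun k : ℕ => cutTime D₀ τ T' x * (1 - 1 / ((k : ℝ) + 2))) atTop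
        (𝓝[Icc 0 (cutTime D₀ τ T' x)] (cutTime D₀ τ T' x)) := by
      refine tendsto_nhdsWithin_iff.2 ⟨?_, Eventually.of_forall fun k =>
        Ioo_subset_Icc_self (hmem k)⟩
      simpa using hlim1.const_mul (cutTime D₀ τ T' x)
    refine (hc.tendsto.comp hseq).congr fun k => ?_
    have hin : (x, cutTime D₀ τ T' x * (1 - 1 / ((k : ℝ) + 2))) ∈ Ω := hmem k
    rw [hXm, piecewise_eq_of_mem _ _ _ hin]
    exact hX.endedPath_eq hx (hmem k)

/-- The regular part of the mass, carried by the trajectories of the velocity field until the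
time `T'`. -/
def sweep (hX : IsEnteringFlow T u Γ K D₀ τ X) {f : Space n → ℝ} (hf : ContDiff ℝ ∞ f)
    {ρ₀ : Space n → ℝ} (hint : IsRegularDensity T u f (cauchyDensity u f D₀ τ X ρ₀)) {T' : ℝ}
    (hT' : 0 < T') (hT'T : T' < T) : Sweep n (Space n) where
  ν := volume
  sigmaFinite := inferInstance
  σ := volume.restrict ((strip n T \ (Γ ∪ K)) ∩ {p | p.2 < T'})
  V := u
  c := fun p => f (u p)
  e := cauchyDensity u f D₀ τ X ρ₀
  F := fun _ => 0
  start := fun _ => 0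
  finish := cutTime D₀ τ T'
  path := endedPath D₀ τ X T'
  amp := endedAmp u f X ρ₀
  weight := fun z => |(fderiv ℝ (fun y => X y z.2) z.1).det|
  measurableSet := (hX.isOpen_domain_cutTime T').measurableSet
  start_le := by
    filter_upwards [hX.mem_ae] with x hx using (hX.cutTime_pos hT' hx).le
  integrable_comp := fun _ hG => (hX.integrable_comp hG).1
  integral_comp := fun _ hG => (hX.integrable_comp hG).2
  amp_eq := by
    filter_upwards [hX.mem_ae] with x hx t ht
    have ht' := Ioo_cutTime_subset hx ht
    rw [(hX.hasDerivAt_rawAmp hf ρ₀ hx).2 t (Ioo_subset_Ico_self ht'), hX.endedPath_eq hx ht,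
      hX.abs_det_mul_cauchyDensity f ρ₀ hx ht']
  continuousOn_path := by
    filter_upwards [hX.mem_ae] with x hx using hX.continuousOn_endedPath hT' hT'T hx
  continuousOn_amp := by
    filter_upwards [hX.mem_ae, hX.intervalIntegrable_endedAmp hint hT' hT'T] with x hx hx'
    have h := intervalIntegral.continuousOn_primitive_interval' hx' left_mem_uIcc
    rw [uIcc_of_le (hX.cutTime_pos hT' hx).le] at h
    exact continuousOn_const.add h
  hasDerivAt_path := by
    filter_upwards [hX.mem_ae] with x hx t ht
    have hev : endedPath D₀ τ X T' x =ᶠ[𝓝 t] X x := by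
      filter_upwards [Ioo_mem_nhds ht.1 ht.2] with s hs using hX.endedPath_eq hx hs
    rw [hX.endedPath_eq hx ht]
    exact (hX.ode x hx t (Ioo_cutTime_subset hx ht)).congr_of_eventuallyEq hev
  hasDerivAt_amp := by
    filter_upwards [hX.mem_ae] with x hx t ht
    have ht' := Ioo_cutTime_subset hx ht
    obtain ⟨h1, h2⟩ := hX.hasDerivAt_rawAmp hf ρ₀ hx
    have hev : endedAmp u f X ρ₀ x =ᶠ[𝓝 t] rawAmp u f X ρ₀ x := by
      filter_upwards [Ioo_mem_nhds ht'.1 ht'.2] with s hs using h2 s (Ioo_subset_Ico_self hs)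
    refine ((h1 t ht').congr_of_eventuallyEq hev).congr_deriv ?_
    rw [hX.endedPath_eq hx ht, h2 t (Ioo_subset_Ico_self ht')]
    ring
  locInt_density := locInt_restrict hint.density _ (inter_subset_left.trans sdiff_subset)
  locInt_flux := locInt_restrict hint.flux _ (inter_subset_left.trans sdiff_subset)
  locInt_damping := locInt_restrict hint.source _ (inter_subset_left.trans sdiff_subset)
  locInt_source := fun r => integrableOn_zero
  aemeasurable_start := by
    refine (measurable_id.prodMk (measurable_const (a := (0 : ℝ)))).aemeasurable.congr ?_
    filter_upwards [hX.mem_ae] with x hx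
    rw [hX.endedPath_zero hT' hx]
    rfl
  aemeasurable_finish := hX.aemeasurable_endedPath_cutTime hT' hT'T

end IsEnteringFlow

/-! ### The flux density of a stratum as a sum of boundary terms. -/

namespace Sweep

variable {n : ℕ} {T : ℝ} {Y : Type*} [MeasurableSpace Y] (A : Sweep n Y)

theorem abs_indicator_one_le {α : Type*} (B : Set α) (p : α) :
    |B.indicator (1 : α → ℝ) p| ≤ 1 := by
  by_cases hp : p ∈ B <;> simp [hp]

theorem boundary_congr {φ ψ : SpaceTime n → ℝ}
    (ho : ∀ᵐ y ∂A.ν, φ (A.path y (A.finish y), A.finish y) = ψ (A.path y (A.finish y), A.finish y))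
    (hi : ∀ᵐ y ∂A.ν, φ (A.path y (A.start y), A.start y) = ψ (A.path y (A.start y), A.start y)) :
    A.boundary φ = A.boundary ψ := by
  refine integral_congr_ae ?_
  filter_upwards [ho, hi] with y h1 h2
  simp only [outflow, inflow, h1, h2]

theorem sum_boundary {K : Type*} (I : Finset K) {φ : SpaceTime n → ℝ}
    (ho : Integrable (A.outflow φ) A.ν) (hi : Integrable (A.inflow φ) A.ν)
    {h : K → SpaceTime n → ℝ} (hm : ∀ k, Measurable (h k)) (hb : ∀ k p, |h k p| ≤ 1) :
    ∑ k ∈ I, A.boundary (fun p => φ p * h k p) = A.boundary fun p => φ p * ∑ k ∈ I, h k p := by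
  simp only [boundary]
  rw [← integral_finsetSum]
  · refine integral_congr_ae (ae_of_all _ fun y => ?_)
    simp only [outflow, inflow, Finset.mul_sum, Finset.sum_sub_distrib]
  · exact fun k _ => (A.integrable_outflow_mul ho (hm k) (hb k)).sub
      (A.integrable_inflow_mul hi (hm k) (hb k))

/-- Either the sweep avoids the stratum between the end points of its trajectories, or it runs in
the stratum and the end points are off the stratum. -/
def AvoidsOrWithin (P : Stratum n T) : Prop :=
  ((∀ᵐ y ∂A.ν, ∀ t ∈ Ioo (A.start y) (A.finish y), (A.path y t, t) ∉ P.carrier) ∧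
    A.σ P.carrier = 0) ∨
  (A.σ P.carrierᶜ = 0 ∧ (∀ y, (A.path y (A.finish y), A.finish y) ∉ P.carrier) ∧
    ∀ y, (A.path y (A.start y), A.start y) ∉ P.carrier)

/-- For a sweep within the stratum both sides vanish: the tube is punctured, hence null for `σ`, and
the end points are off the stratum. -/
theorem AvoidsOrWithin.tendsto_tube_flux {A : Sweep n Y} {P : Stratum n T}
    (hA : A.AvoidsOrWithin P) {ζ : SpaceTime n → ℝ} (hζ : ContDiff ℝ ∞ ζ)
    (hc : HasCompactSupport ζ) (hsupp : tsupport ζ ⊆ P.dom)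
    (ho : Integrable (A.outflow ζ) A.ν) (hi : Integrable (A.inflow ζ) A.ν) :
    Tendsto (fun ε : ℝ => -(ε⁻¹ * ∫ p in P.tube ε,
        ζ p * A.e p * fderiv ℝ (fun q => ‖P.S q‖) p (A.V p, 1) ∂A.σ)) (𝓝[>] 0)
      (𝓝 (A.boundary fun p => ζ p * P.carrier.indicator 1 p)) := by
  rcases hA with ⟨h1, h2⟩ | ⟨h1, h2, h3⟩
  · exact A.tendsto_tube_flux P hζ hc hsupp h1 h2 ho hi
  · have hb : A.boundary (fun p => ζ p * P.carrier.indicator 1 p) = 0 := by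
      simp [boundary, outflow, inflow, h2, h3]
    have ht : ∀ ε, A.σ (P.tube ε) = 0 := fun ε =>
      measure_mono_null (t := P.carrierᶜ)
        (fun p hp (h : p ∈ P.carrier) => hp.2.1.ne' (by rw [h.2, norm_zero])) h1
    simp [hb, Measure.restrict_eq_zero.2 (ht _)]

end Sweep

/-- The density of the flux into a stratum, when the mass is carried by sweeps. -/
theorem IsFluxDensity.integral_mul_eq_boundary {n : ℕ} {T : ℝ} {ι : Type*} {P : Stratum n T}
    {σP : Measure (SpaceTime n)} {u : SpaceTime n → Space n} {R F : SpaceTime n → ℝ}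
    {Y : ι → Type*} [∀ j, MeasurableSpace (Y j)] {A : ∀ j, Sweep n (Y j)}
    (hF : IsFluxDensity P σP u R (fun j => (A j).V) (fun j => (A j).σ) (fun j => (A j).e) F)
    {Y' : Type*} [MeasurableSpace Y'] {B : Sweep n Y'} {I : Finset ι} {ζ : SpaceTime n → ℝ}
    (hζ : ContDiff ℝ ∞ ζ) (hc : HasCompactSupport ζ)
    (hB : ∀ ψ : SpaceTime n → ℝ, (∀ p, ζ p = 0 → ψ p = 0) → ∀ ε,
      ∫ p in P.tube ε, ψ p * R p * fderiv ℝ (fun q => ‖P.S q‖) p (u p, 1) =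
        ∫ p in P.tube ε, ψ p * B.e p * fderiv ℝ (fun q => ‖P.S q‖) p (B.V p, 1) ∂B.σ)
    (hI : ∀ j ∉ I, ∀ᵐ p ∂(A j).σ, ζ p = 0)
    (hBP : B.AvoidsOrWithin P) (hAP : ∀ j, (A j).AvoidsOrWithin P)
    (hBo : Integrable (B.outflow ζ) B.ν) (hBi : Integrable (B.inflow ζ) B.ν)
    (hAo : ∀ j, Integrable ((A j).outflow ζ) (A j).ν)
    (hAi : ∀ j, Integrable ((A j).inflow ζ) (A j).ν) :
    ∫ p in P.carrier, ζ p * F p ∂σP = B.boundary (fun p => ζ p * P.carrier.indicator 1 p) +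
      ∑ j ∈ I, (A j).boundary fun p => ζ p * P.carrier.indicator 1 p := by
  -- The flux density is tested only with functions supported in `P.dom`, while `ζ` need not be. The
  -- formula is proved for `ζ χₖ`, and `k → ∞` is taken by dominated convergence, as `χₖ → 1` on the
  -- stratum.
  obtain ⟨χ, hχs, hχc, hχd, hχb, hχ1⟩ := P.isOpen_dom.exists_smooth_cutoffs
  have hχa : ∀ k p, |χ k p| ≤ 1 := fun k p => by
    rw [abs_of_nonneg (hχb k p).1]
    exact (hχb k p).2
  have hχm : ∀ k, Measurable (χ k) := fun k => (hχs k).continuous.measurable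
  have key : ∀ k, ∫ p in P.carrier, (ζ p * χ k p) * F p ∂σP =
      B.boundary (fun p => (ζ p * χ k p) * P.carrier.indicator 1 p) +
        ∑ j ∈ I, (A j).boundary fun p => (ζ p * χ k p) * P.carrier.indicator 1 p := by
    intro k
    have h1 : ContDiff ℝ ∞ fun p => ζ p * χ k p := hζ.mul (hχs k)
    have h2 : HasCompactSupport fun p => ζ p * χ k p := hc.mul_right
    have h3 : tsupport (fun p => ζ p * χ k p) ⊆ P.dom :=
      (tsupport_mul_subset_right (f := ζ) (g := χ k)).trans (hχd k)
    refine tendsto_nhds_unique (hF.tendsto _ h1 h2 h3) ?_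
    have hlim := (hBP.tendsto_tube_flux h1 h2 h3
      (B.integrable_outflow_mul hBo (hχm k) (hχa k))
      (B.integrable_inflow_mul hBi (hχm k) (hχa k))).add
      (tendsto_finsetSum I fun j _ => (hAP j).tendsto_tube_flux h1 h2 h3
        ((A j).integrable_outflow_mul (hAo j) (hχm k) (hχa k))
        ((A j).integrable_inflow_mul (hAi j) (hχm k) (hχa k)))
    refine hlim.congr fun ε => ?_
    rw [tubeInflux, hB _ (fun p hp => by simp [hp]) ε,
      finsum_eq_sum_of_support_subset (s := I) _ fun j hj => ?_]
    · rw [mul_add, neg_add, Finset.mul_sum, Finset.sum_neg_distrib]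
    · by_contra hjI
      refine hj ?_
      refine integral_eq_zero_of_ae ?_
      filter_upwards [ae_restrict_of_ae (hI j hjI)] with p hp
      simp [hp]
  have hind : Measurable (P.carrier.indicator (1 : SpaceTime n → ℝ)) :=
    measurable_one.indicator P.measurableSet_carrier
  have hlim : ∀ p, Tendsto (fun k => ζ p * (χ k p * P.carrier.indicator 1 p)) atTop
      (𝓝 (ζ p * P.carrier.indicator 1 p)) := by
    intro p
    by_cases hp : p ∈ P.carrier
    · refine tendsto_const_nhds.congr' ?_
      filter_upwards [hχ1 p hp.1] with k hk
      rw [hk, one_mul]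
    · simp [hp]
  have hm : ∀ k, Measurable fun p => χ k p * P.carrier.indicator 1 p := fun k =>
    (hχm k).mul hind
  have hb : ∀ k p, |χ k p * P.carrier.indicator 1 p| ≤ 1 := fun k p => by
    rw [abs_mul]
    exact mul_le_one₀ (hχa k p) (abs_nonneg _) (Sweep.abs_indicator_one_le _ _)
  have hl : Tendsto (fun k => ∫ p in P.carrier, (ζ p * χ k p) * F p ∂σP) atTop
      (𝓝 (∫ p in P.carrier, ζ p * F p ∂σP)) := by
    have hint : Integrable (fun p => F p * ζ p) σP :=
      hF.integrable.integrable_mul_of_hasCompactSupport hζ.continuous hc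
    refine tendsto_integral_of_dominated_convergence (fun p => ‖F p * ζ p‖) (fun k => ?_)
      hint.restrict.norm (fun k => ?_) ?_
    · refine (hint.restrict.aestronglyMeasurable.mul
        (hχm k).aestronglyMeasurable).congr (ae_of_all _ fun p => ?_)
      simp only [Pi.mul_apply]
      ring
    · refine ae_of_all _ fun p => ?_
      rw [show ζ p * χ k p * F p = (F p * ζ p) * χ k p by ring, norm_mul]
      exact mul_le_of_le_one_right (norm_nonneg _) (hχa k p)
    · filter_upwards [ae_restrict_mem P.measurableSet_carrier] with p hp
      refine tendsto_const_nhds.congr' ?_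
      filter_upwards [hχ1 p hp.1] with k hk
      rw [hk, mul_one]
  have hr : Tendsto (fun k => B.boundary (fun p => (ζ p * χ k p) * P.carrier.indicator 1 p) +
        ∑ j ∈ I, (A j).boundary fun p => (ζ p * χ k p) * P.carrier.indicator 1 p) atTop
      (𝓝 (B.boundary (fun p => ζ p * P.carrier.indicator 1 p) +
        ∑ j ∈ I, (A j).boundary fun p => ζ p * P.carrier.indicator 1 p)) := by
    simp only [mul_assoc]
    exact (B.tendsto_boundary hBo hBi (Eventually.of_forall hm) (Eventually.of_forall hb) hlim).add
      (tendsto_finsetSum I fun j _ => (A j).tendsto_boundary (hAo j) (hAi j)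
        (Eventually.of_forall hm) (Eventually.of_forall hb) hlim)
  exact tendsto_nhds_unique (hl.congr key) hr

/-! ### End points of the trajectories in the strata, and the Kirchhoff laws in integrated form. -/

namespace Stratum.Fibration

variable {n : ℕ} {T : ℝ} {P : Stratum n T} {v : SpaceTime n → Space n} {Y : Type*}
  [MeasurableSpace Y] (Φ : P.Fibration v Y)

theorem endpoint_mem_closure (y : Y) {t : ℝ} (ht : t ∈ Icc (Φ.start y) (Φ.finish y)) :
    (Φ.path y t, t) ∈ closure P.carrier := by
  have hcl : t ∈ closure (Ioo (Φ.start y) (Φ.finish y)) := by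
    rwa [closure_Ioo (Φ.start_lt_finish y).ne]
  have hc : ContinuousWithinAt (fun t => ((Φ.path y t, t) : SpaceTime n))
      (Ioo (Φ.start y) (Φ.finish y)) t :=
    (((Φ.continuousOn y).prodMk continuousOn_id) t ht).mono Ioo_subset_Icc_self
  refine closure_mono ?_ (hc.mem_closure_image hcl)
  rintro _ ⟨s, hs, rfl⟩
  exact Φ.mem y s hs

/-- A trajectory with an end point in a ball belongs to a stratum which meets a larger ball. -/
theorem carrier_inter_nonempty (y : Y) {t : ℝ} (ht : t ∈ Icc (Φ.start y) (Φ.finish y)) {r : ℝ}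
    (hr : (Φ.path y t, t) ∈ Metric.closedBall (0 : SpaceTime n) r) :
    (P.carrier ∩ Metric.closedBall 0 (r + 1)).Nonempty := by
  obtain ⟨p, hp, hpd⟩ := Metric.mem_closure_iff.1 (Φ.endpoint_mem_closure y ht) 1 one_pos
  refine ⟨p, hp, ?_⟩
  rw [Metric.mem_closedBall] at hr ⊢
  rw [dist_comm] at hpd
  linarith [dist_triangle p (Φ.path y t, t) 0]

theorem measurable_finishPoint : Measurable fun y => (Φ.path y (Φ.finish y), Φ.finish y) :=
  (Φ.measurable_path.comp (measurable_id.prodMk Φ.measurable_finish)).prodMk Φ.measurable_finish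

theorem measurable_startPoint : Measurable fun y => (Φ.path y (Φ.start y), Φ.start y) :=
  (Φ.measurable_path.comp (measurable_id.prodMk Φ.measurable_start)).prodMk Φ.measurable_start

end Stratum.Fibration

theorem MeasureTheory.IntegrableOn.integrable_mul_of_bounded {Y : Type*} [MeasurableSpace Y]
    {ν : Measure Y} {s : Set Y} {g h : Y → ℝ} (hg : IntegrableOn g s ν) (hh : Measurable h) {C : ℝ}
    (hC : ∀ y, |h y| ≤ C) (hs : ∀ y, h y ≠ 0 → y ∈ s) : Integrable (fun y => g y * h y) ν := by
  refine (integrableOn_iff_integrable_of_support_subset fun y hy => hs y ?_).1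
    (hg.mul_bdd hh.aestronglyMeasurable (ae_of_all _ hC))
  exact right_ne_zero_of_mul hy

namespace KirchhoffLaws

variable {n : ℕ} {T : ℝ} {ι : Type*} {Γ : ι → Stratum n T} {v : ι → SpaceTime n → Space n}
  {Y : ι → Type*} [∀ i, MeasurableSpace (Y i)] {Φ : ∀ i, (Γ i).Fibration (v i) (Y i)}
  {ν : ∀ i, Measure (Y i)} {K : Set (SpaceTime n)} {w : ∀ i, Y i → ℝ → ℝ}

/-- The support condition is restricted to `0 ≤ p.2` because a test function may be nonzero at
negative times, which no end point reaches. -/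
theorem integrable_finish_mul (h : KirchhoffLaws Φ ν K w) (i : ι) {φ : SpaceTime n → ℝ}
    (hφ : Measurable φ) {C r : ℝ} (hC : ∀ p, |φ p| ≤ C)
    (hs : ∀ p : SpaceTime n, 0 ≤ p.2 → φ p ≠ 0 → p ∈ strip n T ∩ Metric.closedBall 0 r) :
    Integrable (fun y => w i y ((Φ i).finish y) *
      φ ((Φ i).path y ((Φ i).finish y), (Φ i).finish y)) (ν i) := by
  refine (h.integrable_finish i r).integrable_mul_of_bounded
    (hφ.comp (Φ i).measurable_finishPoint) (fun y => hC _) fun y hy => ?_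
  have h1 := hs _ (((Φ i).start_nonneg y).trans ((Φ i).start_lt_finish y).le) hy
  exact ⟨h1.1.2, h1.2⟩

theorem integrable_start_mul (h : KirchhoffLaws Φ ν K w) (i : ι) {φ : SpaceTime n → ℝ}
    (hφ : Measurable φ) {C r : ℝ} (hC : ∀ p, |φ p| ≤ C)
    (hs : ∀ p : SpaceTime n, 0 ≤ p.2 → φ p ≠ 0 → p ∈ strip n T ∩ Metric.closedBall 0 r) :
    Integrable (fun y => w i y ((Φ i).start y) *
      φ ((Φ i).path y ((Φ i).start y), (Φ i).start y)) (ν i) := by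
  refine (h.integrable_start i r).integrable_mul_of_bounded
    (hφ.comp (Φ i).measurable_startPoint) (fun y => hC _) fun y hy => ?_
  have h1 := hs _ ((Φ i).start_nonneg y) hy
  exact ⟨h1.1.1, h1.2⟩

/-- The Kirchhoff laws in integrated form. -/
theorem sum_integral_eq_zero (h : KirchhoffLaws Φ ν K w) (hK : MeasurableSet K)
    (hKT : K ⊆ strip n T) {r : ℝ} {I : Finset ι}
    (hI : ∀ i ∉ I, ∀ y, ∀ t ∈ Icc ((Φ i).start y) ((Φ i).finish y),
      ((Φ i).path y t, t) ∉ Metric.closedBall (0 : SpaceTime n) r)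
    {φ : SpaceTime n → ℝ} (hφ : Measurable φ) {C : ℝ} (hC : ∀ p, |φ p| ≤ C)
    (hr : ∀ p, φ p ≠ 0 → p ∈ Metric.closedBall (0 : SpaceTime n) r) :
    ∑ i ∈ I, ∫ y, (w i y ((Φ i).finish y) *
        (φ ((Φ i).path y ((Φ i).finish y), (Φ i).finish y) *
          K.indicator 1 ((Φ i).path y ((Φ i).finish y), (Φ i).finish y)) -
      w i y ((Φ i).start y) *
        (φ ((Φ i).path y ((Φ i).start y), (Φ i).start y) *
          K.indicator 1 ((Φ i).path y ((Φ i).start y), (Φ i).start y))) ∂(ν i) = 0 := by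
  set κ : SpaceTime n → ℝ := (K ∩ Metric.closedBall 0 r).indicator 1 with hκ
  have hKm : MeasurableSet (K ∩ Metric.closedBall (0 : SpaceTime n) r) :=
    hK.inter Metric.isClosed_closedBall.measurableSet
  have hκm : Measurable κ := measurable_one.indicator hKm
  have hκs : ∀ p : SpaceTime n, 0 ≤ p.2 → κ p ≠ 0 → p ∈ strip n T ∩ Metric.closedBall 0 r :=
    fun p _ hp => by
      have := mem_of_indicator_ne_zero hp
      exact ⟨hKT this.1, this.2⟩
  have hκ1 : ∀ p, |κ p| ≤ 1 := fun p => Sweep.abs_indicator_one_le _ _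
  -- The Boolean separates final points (`true`, sign plus) from initial points (`false`, sign
  -- minus), so that the balance says that one finite sum of signed image measures vanishes.
  let pt : ∀ k : ι × Bool, Y k.1 → SpaceTime n := fun k y =>
    if k.2 then ((Φ k.1).path y ((Φ k.1).finish y), (Φ k.1).finish y)
    else ((Φ k.1).path y ((Φ k.1).start y), (Φ k.1).start y)
  let g : ∀ k : ι × Bool, Y k.1 → ℝ := fun k y =>
    if k.2 then w k.1 y ((Φ k.1).finish y) *
      κ ((Φ k.1).path y ((Φ k.1).finish y), (Φ k.1).finish y)
    else -(w k.1 y ((Φ k.1).start y) *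
      κ ((Φ k.1).path y ((Φ k.1).start y), (Φ k.1).start y))
  have hgi : ∀ k, Integrable (g k) (ν k.1) := by
    rintro ⟨i, _ | _⟩
    · simpa [g] using (h.integrable_start_mul i hκm hκ1 hκs).neg
    · simpa [g] using h.integrable_finish_mul i hκm hκ1 hκs
  have hptm : ∀ k, Measurable (pt k) := by
    rintro ⟨i, _ | _⟩
    · simpa [pt] using (Φ i).measurable_startPoint
    · simpa [pt] using (Φ i).measurable_finishPoint
  have hset : ∀ (i : ι) (b : Y i → SpaceTime n) (W : Y i → ℝ), Measurable b →
      ∀ S, MeasurableSet S → ∫ y in b ⁻¹' S, W y * κ (b y) ∂(ν i) =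
        ∫ y in {y | b y ∈ S ∩ (K ∩ Metric.closedBall 0 r)}, W y ∂(ν i) := by
    intro i b W hb S hS
    have hm : MeasurableSet {y | b y ∈ S ∩ (K ∩ Metric.closedBall 0 r)} := hb (hS.inter hKm)
    rw [← integral_indicator (hb hS), ← integral_indicator hm]
    refine integral_congr_ae (ae_of_all _ fun y => ?_)
    by_cases h1 : b y ∈ S <;> by_cases h2 : b y ∈ K ∩ Metric.closedBall (0 : SpaceTime n) r <;>
      simp [indicator, hκ, h1, h2]
  have hres := sum_integral_eq_zero_of_sum_setIntegral_eq_zero (I ×ˢ (Finset.univ : Finset Bool))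
    (fun k => ν k.1) pt hptm g (fun k _ => hgi k) ?_ φ hφ C hC
  · rw [Finset.sum_product] at hres
    rw [← hres]
    refine Finset.sum_congr rfl fun i _ => ?_
    rw [Fintype.sum_bool]
    have i1 : Integrable (fun y => φ (pt (i, true) y) * g (i, true) y) (ν i) :=
      (hgi (i, true)).bdd_mul (hφ.comp (hptm (i, true))).aestronglyMeasurable
        (ae_of_all _ fun y => hC _)
    have i2 : Integrable (fun y => φ (pt (i, false) y) * g (i, false) y) (ν i) :=
      (hgi (i, false)).bdd_mul (hφ.comp (hptm (i, false))).aestronglyMeasurable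
        (ae_of_all _ fun y => hC _)
    rw [← integral_add i1 i2]
    have hφκ : ∀ p, φ p * K.indicator 1 p = φ p * κ p := by
      intro p
      by_cases hp : φ p = 0
      · simp [hp]
      · have := hr p hp
        by_cases hpK : p ∈ K
        · have h1 : p ∈ K ∩ Metric.closedBall 0 r := ⟨hpK, this⟩
          rw [hκ, indicator_of_mem hpK, indicator_of_mem h1]
        · have h1 : p ∉ K ∩ Metric.closedBall 0 r := fun h => hpK h.1
          rw [hκ, indicator_of_notMem hpK, indicator_of_notMem h1]
    refine integral_congr_ae (ae_of_all _ fun y => ?_)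
    simp only [hφκ, pt, g, if_true, Bool.false_eq_true, if_false]
    ring
  · intro S hS
    have hbal := h.balance (S ∩ (K ∩ Metric.closedBall 0 r))
      (inter_subset_right.trans inter_subset_left) (hS.inter hKm)
      (Metric.isBounded_closedBall.subset (inter_subset_right.trans inter_subset_right))
    rw [finsum_eq_sum_of_support_subset (s := I) _ fun i hi => ?_,
      finsum_eq_sum_of_support_subset (s := I) _ fun i hi => ?_] at hbal
    · rw [Finset.sum_product]
      simp only [Fintype.sum_bool, pt, g, if_true, Bool.false_eq_true, if_false, integral_neg]
      rw [Finset.sum_add_distrib]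
      simp only [hset _ _ _ (Φ _).measurable_finishPoint S hS,
        hset _ _ _ (Φ _).measurable_startPoint S hS, Finset.sum_neg_distrib]
      rw [hbal, add_neg_cancel]
    · by_contra hiI
      refine hi ?_
      have : {y | ((Φ i).path y ((Φ i).start y), (Φ i).start y) ∈
          S ∩ (K ∩ Metric.closedBall 0 r)} = ∅ := eq_empty_of_forall_notMem fun y hy =>
        hI i hiI y _ ⟨le_rfl, ((Φ i).start_lt_finish y).le⟩ hy.2.2
      simp only [this, Measure.restrict_empty, integral_zero_measure]
    · by_contra hiI
      refine hi ?_
      have : {y | ((Φ i).path y ((Φ i).finish y), (Φ i).finish y) ∈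
          S ∩ (K ∩ Metric.closedBall 0 r)} = ∅ := eq_empty_of_forall_notMem fun y hy =>
        hI i hiI y _ ⟨((Φ i).start_lt_finish y).le, le_rfl⟩ hy.2.2
      simp only [this, Measure.restrict_empty, integral_zero_measure]

end KirchhoffLaws

/-! ### The integral identity. -/

theorem strataUnion_subset_strip {n : ℕ} {T : ℝ} {ι : Type*} (Γ : ι → Stratum n T) :
    strataUnion Γ ⊆ strip n T := iUnion_subset fun i => (Γ i).carrier_subset_strip

/-- A test function which vanishes at the initial time is supported in a ball and before some
time `T' < T`. -/
theorem exists_support_bounds {n : ℕ} {T : ℝ} (hT : 0 < T) {ζ : SpaceTime n → ℝ}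
    (hc : HasCompactSupport ζ) (hs : tsupport ζ ⊆ {p | p.2 < T}) :
    ∃ T' r : ℝ, 0 < T' ∧ T' < T ∧ ∀ p ∈ tsupport ζ, p.2 < T' ∧ p ∈ Metric.closedBall 0 r := by
  obtain ⟨r, hr⟩ := hc.exists_closedBall
  have hr' : ∀ p ∈ tsupport ζ, p ∈ Metric.closedBall 0 r := fun p hp => by
    by_contra hcon
    exact hr p hcon hp
  rcases (tsupport ζ).eq_empty_or_nonempty with he | hne
  · refine ⟨T / 2, r, by linarith, by linarith, fun p hp => ?_⟩
    rw [he] at hp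
    exact hp.elim
  · obtain ⟨p₀, hp₀, hmax⟩ := hc.isCompact.exists_isMaxOn hne
      (continuous_snd (X := Space n) (Y := ℝ)).continuousOn
    have h1 : p₀.2 < T := hs hp₀
    -- The midpoint of the latest time in the support and `T` gives a strict bound; `T / 2` keeps
    -- `T'` positive when the support lies in negative times.
    refine ⟨max ((p₀.2 + T) / 2) (T / 2), r, lt_max_of_lt_right (by linarith),
      max_lt (by linarith) (by linarith), fun p hp => ⟨lt_max_of_lt_left ?_, hr' p hp⟩⟩
    have := hmax hp
    simp only [mem_ofPred_eq] at this
    linarith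

theorem setIntegral_strip_eq {n : ℕ} {T T' : ℝ} {N : Set (SpaceTime n)} (hN : volume N = 0)
    {S : Set (SpaceTime n)} (hSm : MeasurableSet S) (hS : S ⊆ strip n T)
    {g : SpaceTime n → ℝ} (hg : ∀ p : SpaceTime n, T' ≤ p.2 → g p = 0) :
    ∫ p in S, g p = ∫ p in S, g p ∂(volume.restrict ((strip n T \ N) ∩ {p | p.2 < T'})) := by
  rw [Measure.restrict_restrict hSm]
  refine setIntegral_eq_of_subset_of_ae_sdiff_eq_zero hSm.nullMeasurableSet inter_subset_left ?_
  filter_upwards [measure_eq_zero_iff_ae_notMem.1 hN] with p hp hpS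
  by_contra hcon
  refine hpS.2 ⟨hpS.1, ⟨hS hpS.1, hp⟩, ?_⟩
  by_contra h
  exact hcon (hg p (not_lt.1 h))

/-- The integral identity of generalized δ-shock-type solutions. -/
theorem SolvesStrata.integral_identity {n : ℕ} {T : ℝ} (hT : 0 < T) {ι κ : Type*}
    {Γ : ι → Stratum n T} {J : κ → Stratum n T} (hstrat : IsStratified (Sum.elim Γ J))
    {u : SpaceTime n → Space n} {f : Space n → ℝ} (hf : ContDiff ℝ ∞ f)
    {D₀ : Set (Space n)} {τ : Space n → ℝ} {X : Space n → ℝ → Space n}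
    (hX : IsEnteringFlow T u (strataUnion Γ) (strataUnion J) D₀ τ X)
    {σ : ι → Measure (SpaceTime n)} (hσ : ∀ i, (Γ i).IsLerayMeasure (σ i))
    {v : ι → SpaceTime n → Space n} {Y : ι → Type*} [∀ i, MeasurableSpace (Y i)]
    {Φ : ∀ i, (Γ i).Fibration (v i) (Y i)} {ν : ∀ i, Measure (Y i)} [∀ i, SigmaFinite (ν i)]
    {μ : ι → SpaceTime n → ℝ} (hμ : ∀ i, (Φ i).IsDensity (ν i) (σ i) (μ i))
    {ρ₀ : Space n → ℝ} {w₀ : ∀ i, Y i → ℝ}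
    (hint : IsRegularDensity T u f (cauchyDensity u f D₀ τ X ρ₀))
    {e F : ι → SpaceTime n → ℝ} {w : ∀ i, Y i → ℝ → ℝ}
    (hS : SolvesStrata Φ ν (strataUnion J) u f σ μ w₀ (cauchyDensity u f D₀ τ X ρ₀) e F w)
    {ζ : SpaceTime n → ℝ} (hζ : ContDiff ℝ ∞ ζ) (hc : HasCompactSupport ζ)
    (hsupp : tsupport ζ ⊆ {p | p.2 < T}) (hζ0 : ∀ x, ζ (x, 0) = 0) :
    (∫ p in strip n T, cauchyDensity u f D₀ τ X ρ₀ p *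
        (fderiv ℝ ζ p (u p, 1) - f (u p) * ζ p)) +
      ∑ᶠ i, ∫ p in (Γ i).carrier,
        e i p * (fderiv ℝ ζ p (v i p, 1) - f (v i p) * ζ p) ∂(σ i) = 0 := by
  obtain ⟨T', r, hT'0, hT'T, hbt⟩ := exists_support_bounds hT hc hsupp
  have hbd : ∀ p, ζ p ≠ 0 → p.2 < T' ∧ p ∈ Metric.closedBall 0 r := fun p hp =>
    hbt p (subset_tsupport ζ hp)
  have hfz : ∀ p ∉ tsupport ζ, fderiv ℝ ζ p = 0 := fun p hp =>
    image_eq_zero_of_notMem_tsupport fun h => hp (tsupport_fderiv_subset ℝ h)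
  obtain ⟨C, hC⟩ := hζ.continuous.bounded_above_of_compact_support hc
  have hζm : Measurable ζ := hζ.continuous.measurable
  have hζlate : ∀ p : SpaceTime n, T' ≤ p.2 → ζ p = 0 := fun p hp => by
    by_contra h
    exact ((hbd p h).1.trans_le hp).false
  have hζstrip : ∀ p : SpaceTime n, 0 ≤ p.2 → ζ p ≠ 0 →
      p ∈ strip n T ∩ Metric.closedBall 0 r := by
    intro p hp0 hp
    refine ⟨⟨hp0.lt_of_ne' fun h => hp ?_, (hbd p hp).1.trans hT'T⟩, (hbd p hp).2⟩
    obtain ⟨x, t⟩ := p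
    simp only at h
    rw [h]
    exact hζ0 x
  obtain ⟨hΓm, hΓ0⟩ := measurableSet_strataUnion hstrat.finite_left
  obtain ⟨hJm, hJ0⟩ := measurableSet_strataUnion hstrat.finite_right
  have hN0 : volume (strataUnion Γ ∪ strataUnion J) = 0 := measure_union_null hΓ0 hJ0
  have hdisj : ∀ i j, i ≠ j → Disjoint (Γ i).carrier (Γ j).carrier := fun i j hij =>
    hstrat.disjoint (Sum.inl i) (Sum.inl j) fun h => hij (Sum.inl_injective h)
  have hdisjJ : Disjoint (strataUnion Γ) (strataUnion J) := by
    rw [strataUnion, strataUnion, disjoint_iUnion_left]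
    refine fun i => disjoint_iUnion_right.2 fun j => ?_
    exact hstrat.disjoint (Sum.inl i) (Sum.inr j) (by simp)
  -- The radius is enlarged by 1 because end points lie only in the closure of their stratum: an end
  -- point in the ball of radius `r` forces the stratum to meet the larger one.
  set I : Finset ι := (hstrat.finite_left (r + 1)).toFinset with hIdef
  have hmemI : ∀ i, ((Γ i).carrier ∩ Metric.closedBall 0 (r + 1)).Nonempty → i ∈ I := fun i hi =>
    (hstrat.finite_left (r + 1)).mem_toFinset.2 hi
  have hIpath : ∀ i ∉ I, ∀ y, ∀ t ∈ Icc ((Φ i).start y) ((Φ i).finish y),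
      ((Φ i).path y t, t) ∉ Metric.closedBall (0 : SpaceTime n) r := fun i hi y t ht hmem =>
    hi (hmemI i ((Φ i).carrier_inter_nonempty y ht hmem))
  have hIζ : ∀ i ∉ I, ∀ p ∈ (Γ i).carrier, ζ p = 0 := by
    intro i hi p hp
    by_contra h
    exact hi (hmemI i ⟨p, hp, Metric.closedBall_subset_closedBall (by linarith) (hbd p h).2⟩)
  have hσae : ∀ i, ∀ᵐ p ∂(σ i), p ∈ (Γ i).carrier := fun i => (hσ i).concentrated
  let A : ∀ i, Sweep n (Y i) := fun i =>
    (Φ i).sweep (hμ i) (hS.amplitude i) (hS.flux i).integrable (hS.transport i)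
  let B : Sweep n (Space n) := hX.sweep hf hint hT'0 hT'T
  have hAo : ∀ i, Integrable ((A i).outflow ζ) (A i).ν := fun i =>
    hS.kirchhoff.integrable_finish_mul i hζm hC hζstrip
  have hAi : ∀ i, Integrable ((A i).inflow ζ) (A i).ν := fun i =>
    hS.kirchhoff.integrable_start_mul i hζm hC hζstrip
  have hBi0 : B.inflow ζ = 0 := by
    funext x
    have : ζ (B.path x (B.start x), B.start x) = 0 := hζ0 _
    simp [Sweep.inflow, this]
  have hBi : Integrable (B.inflow ζ) B.ν := by
    rw [hBi0]
    exact integrable_zero _ _ _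
  obtain ⟨b1, b2, b3, b4, b5⟩ := B.integral_fderiv_eq_boundary hζ hc
  -- The balance only gives integrability of outflow minus inflow; here the inflow is zero because
  -- `ζ` vanishes at `t = 0`.
  have hBo : Integrable (B.outflow ζ) B.ν := by simpa [hBi0] using b4
  have hAvB : ∀ i, B.AvoidsOrWithin (Γ i) := by
    intro i
    refine Or.inl ⟨?_, Measure.absolutelyContinuous_of_le Measure.restrict_le_self
      (Γ i).volume_carrier⟩
    have h0 : ∀ᵐ x ∂B.ν, x ∈ D₀ := hX.mem_ae
    filter_upwards [h0] with x hx t ht hmem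
    have h1 : B.path x t = X x t := hX.endedPath_eq hx ht
    rw [h1] at hmem
    exact hX.avoid x hx t (IsEnteringFlow.Ioo_cutTime_subset hx ht)
      (Or.inl (mem_iUnion.2 ⟨i, hmem⟩))
  have hAvA : ∀ i j, (A j).AvoidsOrWithin (Γ i) := by
    intro i j
    by_cases hij : j = i
    · subst hij
      exact Or.inr ⟨(hσ j).concentrated, (Φ j).finish_not_mem, (Φ j).start_not_mem⟩
    · refine Or.inl ⟨ae_of_all _ fun y t ht hmem =>
        disjoint_left.1 (hdisj j i hij) ((Φ j).mem y t ht) hmem, ?_⟩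
      exact measure_mono_null (fun p hp h => disjoint_left.1 (hdisj j i hij) h hp)
        (hσ j).concentrated
  have hflux : ∀ i, ∫ p in (Γ i).carrier, ζ p * F i p ∂(σ i) =
      B.boundary (fun p => ζ p * (Γ i).carrier.indicator 1 p) +
        ∑ j ∈ I, (A j).boundary fun p => ζ p * (Γ i).carrier.indicator 1 p := by
    intro i
    refine IsFluxDensity.integral_mul_eq_boundary (A := A) (hS.flux i) hζ hc ?_ ?_ (hAvB i)
      (hAvA i) hBo hBi hAo hAi
    -- The sweep `B` sees only times before `T'` and points off the null singular set; nothing is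
    -- lost, since `ψ` vanishes with `ζ` after `T'`.
    · intro ψ hψ ε
      exact setIntegral_strip_eq hN0 ((Γ i).isOpen_tube ε).measurableSet
        (fun p hp => (Γ i).dom_subset hp.1) fun p hp => by simp [hψ p (hζlate p hp)]
    · intro j hj
      have := hσae j
      filter_upwards [this] with p hp using hIζ j hj p hp
  have hone : ∀ i, Measurable ((Γ i).carrier.indicator (1 : SpaceTime n → ℝ)) := fun i =>
    measurable_one.indicator (Γ i).measurableSet_carrier
  have hsumind : ∀ p, ζ p * ∑ i ∈ I, (Γ i).carrier.indicator 1 p =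
      ζ p * (strataUnion Γ).indicator 1 p := by
    intro p
    by_cases hζp : ζ p = 0
    · simp [hζp]
    by_cases hp : p ∈ strataUnion Γ
    · obtain ⟨i, hi⟩ := mem_iUnion.1 hp
      have hiI : i ∈ I := by
        by_contra h
        exact hζp (hIζ i h p hi)
      rw [Finset.sum_eq_single_of_mem i hiI fun j _ hji =>
        indicator_of_notMem (disjoint_right.1 (hdisj j i hji) hi) _, indicator_of_mem hi,
        indicator_of_mem hp]
    · rw [indicator_of_notMem hp, Finset.sum_eq_zero fun i _ =>
        indicator_of_notMem (fun hi => hp (mem_iUnion.2 ⟨i, hi⟩)) _]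
  -- The regular mass reaching the support of `ζ` ends on `Γ` almost surely, the other end points
  -- being at time `T'`; so its whole outflow is absorbed by the strata.
  have hBsum : ∑ i ∈ I, B.boundary (fun p => ζ p * (Γ i).carrier.indicator 1 p) =
      B.boundary ζ := by
    rw [B.sum_boundary I hBo hBi hone fun i => Sweep.abs_indicator_one_le _]
    refine B.boundary_congr ?_ (ae_of_all _ fun x => ?_)
    · have h0 : ∀ᵐ x ∂B.ν, (B.path x (B.finish x), B.finish x) ∈ strataUnion Γ ∨
          B.finish x = T' := hX.endedPath_cutTime_mem hT'0 hT'T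
      filter_upwards [h0] with x hx
      rw [hsumind]
      rcases hx with hx | hx
      · rw [indicator_of_mem hx, Pi.one_apply, mul_one]
      · rw [hζlate _ hx.ge, zero_mul]
    · have : ζ (B.path x (B.start x), B.start x) = 0 := hζ0 _
      rw [this, zero_mul]
  have hAsum : ∀ j, ∑ i ∈ I, (A j).boundary (fun p => ζ p * (Γ i).carrier.indicator 1 p) =
      (A j).boundary fun p => ζ p * (strataUnion Γ).indicator 1 p := by
    intro j
    rw [(A j).sum_boundary I (hAo j) (hAi j) hone fun i => Sweep.abs_indicator_one_le _]
    simp only [hsumind]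
  -- Where `ζ ≠ 0` an end point is in the strip and in the closure of the strata, hence on `Γ` or on
  -- a junction, and these are disjoint.
  have hend : ∀ j y, ∀ t ∈ Icc ((Φ j).start y) ((Φ j).finish y),
      ζ ((Φ j).path y t, t) =
        ζ ((Φ j).path y t, t) * (strataUnion Γ).indicator 1 ((Φ j).path y t, t) +
        ζ ((Φ j).path y t, t) * (strataUnion J).indicator 1 ((Φ j).path y t, t) := by
    intro j y t ht
    set p : SpaceTime n := ((Φ j).path y t, t) with hp
    by_cases hζp : ζ p = 0
    · simp [hζp]
    have hps := (hζstrip p (((Φ j).start_nonneg y).trans ht.1) hζp).1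
    have hcl : p ∈ closure (strataUnion (Sum.elim Γ J)) :=
      closure_mono (fun q hq => mem_iUnion.2 ⟨Sum.inl j, hq⟩) ((Φ j).endpoint_mem_closure y ht)
    have hU := hstrat.closed ⟨hcl, hps⟩
    rw [strataUnion_sumElim] at hU
    rcases hU with h | h
    · simp [indicator_of_mem h, indicator_of_notMem (disjoint_left.1 hdisjJ h)]
    · simp [indicator_of_mem h, indicator_of_notMem (disjoint_right.1 hdisjJ h)]
  have hAsplit : ∀ j, (A j).boundary ζ =
      (A j).boundary (fun p => ζ p * (strataUnion Γ).indicator 1 p) +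
        (A j).boundary fun p => ζ p * (strataUnion J).indicator 1 p := by
    intro j
    have hm1 := measurable_one (α := ℝ).indicator hΓm
    have hm2 := measurable_one (α := ℝ).indicator hJm
    rw [← (A j).boundary_add
      ((A j).integrable_outflow_mul (hAo j) hm1 (Sweep.abs_indicator_one_le _))
      ((A j).integrable_inflow_mul (hAi j) hm1 (Sweep.abs_indicator_one_le _))
      ((A j).integrable_outflow_mul (hAo j) hm2 (Sweep.abs_indicator_one_le _))
      ((A j).integrable_inflow_mul (hAi j) hm2 (Sweep.abs_indicator_one_le _))]
    exact (A j).boundary_congr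
      (ae_of_all _ fun y => hend j y _ ⟨((Φ j).start_lt_finish y).le, le_rfl⟩)
      (ae_of_all _ fun y => hend j y _ ⟨le_rfl, ((Φ j).start_lt_finish y).le⟩)
  have hkir : ∑ j ∈ I, (A j).boundary (fun p => ζ p * (strataUnion J).indicator 1 p) = 0 :=
    hS.kirchhoff.sum_integral_eq_zero hJm (strataUnion_subset_strip J) hIpath hζm hC
      fun p hp => (hbd p hp).2
  have hreg : ∫ p in strip n T, cauchyDensity u f D₀ τ X ρ₀ p *
      (fderiv ℝ ζ p (u p, 1) - f (u p) * ζ p) = B.boundary ζ := by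
    rw [setIntegral_strip_eq hN0 (isOpen_strip n T).measurableSet subset_rfl, ← b5,
      Measure.restrict_restrict (isOpen_strip n T).measurableSet,
      inter_eq_self_of_subset_right (inter_subset_left.trans sdiff_subset)]
    · refine integral_congr_ae (ae_of_all _ fun p => ?_)
      change cauchyDensity u f D₀ τ X ρ₀ p * (fderiv ℝ ζ p (u p, 1) - f (u p) * ζ p) =
        cauchyDensity u f D₀ τ X ρ₀ p * fderiv ℝ ζ p (u p, 1) -
          f (u p) * cauchyDensity u f D₀ τ X ρ₀ p * ζ p + 0 * ζ p
      ring
    · intro p hp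
      rw [hfz p fun h => ((hbt p h).1.trans_le hp).false, hζlate p hp]
      simp
  have hsing : ∀ i, ∫ p in (Γ i).carrier,
      e i p * (fderiv ℝ ζ p (v i p, 1) - f (v i p) * ζ p) ∂(σ i) =
        (A i).boundary ζ - ∫ p in (Γ i).carrier, ζ p * F i p ∂(σ i) := by
    intro i
    obtain ⟨a1, a2, a3, -, a5⟩ := (A i).integral_fderiv_eq_boundary hζ hc
    rw [← a5, Measure.restrict_eq_self_of_ae_mem (hσae i), eq_sub_iff_add_eq]
    have i1 : Integrable (fun p => e i p * (fderiv ℝ ζ p (v i p, 1) - f (v i p) * ζ p)) (σ i) := by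
      refine (a1.sub a2).congr (ae_of_all _ fun p => ?_)
      change e i p * fderiv ℝ ζ p (v i p, 1) - f (v i p) * e i p * ζ p = _
      ring
    have i2 : Integrable (fun p => ζ p * F i p) (σ i) :=
      a3.congr (ae_of_all _ fun p => mul_comm _ _)
    rw [← integral_add i1 i2]
    refine integral_congr_ae (ae_of_all _ fun p => ?_)
    change e i p * (fderiv ℝ ζ p (v i p, 1) - f (v i p) * ζ p) + ζ p * F i p =
      e i p * fderiv ℝ ζ p (v i p, 1) - f (v i p) * e i p * ζ p + F i p * ζ p
    ring
  rw [hreg, finsum_eq_sum_of_support_subset (s := I) _ fun i hi => ?_]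
  -- Exchanging the sums over receiving strata `i` and carrying strata `j` turns the total flux into
  -- the boundary terms on all of `Γ`; what then remains is the sum of junction terms, which is zero
  -- by `hkir`.
  · have htot : ∑ i ∈ I, ∫ p in (Γ i).carrier, ζ p * F i p ∂(σ i) = B.boundary ζ +
        ∑ j ∈ I, (A j).boundary fun p => ζ p * (strataUnion Γ).indicator 1 p := by
      rw [Finset.sum_congr rfl fun i _ => hflux i, Finset.sum_add_distrib, hBsum,
        Finset.sum_comm, Finset.sum_congr rfl fun j _ => hAsum j]
    rw [Finset.sum_congr rfl fun i _ => hsing i, Finset.sum_sub_distrib, htot,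
      Finset.sum_congr rfl fun j _ => hAsplit j, Finset.sum_add_distrib, hkir]
    ring
  · by_contra hiI
    refine hi ?_
    refine integral_eq_zero_of_ae ?_
    filter_upwards [ae_restrict_mem (Γ i).measurableSet_carrier] with p hp
    rw [hfz p fun h => hiI (hmemI i
      ⟨p, hp, Metric.closedBall_subset_closedBall (by linarith) (hbt p h).2⟩), hIζ i hiI p hp]
    simp

end

theorem theorem1 {n : ℕ} {T : ℝ} (hT : 0 < T)
    {ι κ : Type*}
    -- the strata carrying the delta functions, and the strata along which they are joined
    (Γ : ι → Stratum n T) (J : κ → Stratum n T)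
    (hstrat : IsStratified (Sum.elim Γ J))
    -- the velocity field, its trajectories, and the coefficient
    (u : SpaceTime n → Space n)
    (hu : ContDiffOn ℝ ∞ u (strip n T \ (strataUnion Γ ∪ strataUnion J)))
    (f : Space n → ℝ) (hf : ContDiff ℝ ∞ f)
    (D₀ : Set (Space n)) (τ : Space n → ℝ) (X : Space n → ℝ → Space n)
    (hX : IsEnteringFlow T u (strataUnion Γ) (strataUnion J) D₀ τ X)
    -- Leray measures, velocities and trajectories on the strata
    (σ : ι → Measure (SpaceTime n)) (hσ : ∀ i, (Γ i).IsLerayMeasure (σ i))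
    (v : ι → SpaceTime n → Space n) (hv : ∀ i, (Γ i).IsVelocity (v i))
    {Y : ι → Type*} [∀ i, MeasurableSpace (Y i)]
    (Φ : ∀ i, (Γ i).Fibration (v i) (Y i))
    (ν : ∀ i, Measure (Y i)) [∀ i, SigmaFinite (ν i)]
    (μ : ι → SpaceTime n → ℝ) (hμ : ∀ i, (Φ i).IsDensity (ν i) (σ i) (μ i))
    -- initial data
    (ρ₀ : Space n → ℝ) (hρ₀ : ContDiffOn ℝ ∞ ρ₀ D₀) (w₀ : ∀ i, Y i → ℝ)
    (hint : IsRegularDensity T u f (cauchyDensity u f D₀ τ X ρ₀))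
    -- solvability of the equations on the strata, with the Kirchhoff laws
    (hsolv : ∃ (e F : ι → SpaceTime n → ℝ) (w : ∀ i, Y i → ℝ → ℝ),
      SolvesStrata Φ ν (strataUnion J) u f σ μ w₀ (cauchyDensity u f D₀ τ X ρ₀) e F w) :
    ∃ (R : SpaceTime n → ℝ) (e : ι → SpaceTime n → ℝ),
      IsDeltaShockSolution Γ (strataUnion J) u f v σ R e ∧
      (∀ x₀ ∈ D₀, ∀ t ∈ Ico 0 (τ x₀), R (X x₀ t, t) = alongTrajectory u f X ρ₀ x₀ t) ∧
      (∀ x₀ ∈ D₀, R (x₀, 0) = ρ₀ x₀) ∧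
      ∃ (F : ι → SpaceTime n → ℝ) (w : ∀ i, Y i → ℝ → ℝ),
        SolvesStrata Φ ν (strataUnion J) u f σ μ w₀ R e F w := by
  obtain ⟨e, F, w, hS⟩ := hsolv
  refine ⟨cauchyDensity u f D₀ τ X ρ₀, e, ⟨hX.contDiffOn_cauchyDensity hf hρ₀, hint, hS.amplitude,
    fun ζ hζ hc hsupp hζ0 => hS.integral_identity hT hstrat hf hX hσ hμ hint hζ hc hsupp hζ0⟩,
    fun x₀ hx₀ t ht => hX.cauchyDensity_apply f ρ₀ hx₀ ht, fun x₀ hx₀ => ?_, F, w, hS⟩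
  have h := hX.cauchyDensity_apply f ρ₀ hx₀ (t := 0) ⟨le_rfl, hX.pos x₀ hx₀⟩
  rwa [hX.init x₀ hx₀, hX.alongTrajectory_zero f ρ₀ hx₀] at h
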